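/- Let $n,m\ge 1$, and let $\phi:\mathbb{R}^n\to\mathbb{R}^m$ satisfy the following condition: all coordinates of $\phi$ are continuous, and there are a bounded open set $E\subset\mathbb{R}^n$ and a number $\delta^*>0$ such that for every unit vector $x\in\mathbb{R}^m$ the set $\{y\in\overline{E}:|\phi(y)^\tau x|=\delta^*\}$ has Jordan measure zero, and $$\inf_{\|x\|=1}\ell\big(\{y\in E:|\phi(y)^\tau x|>\delta^*\}\big)>0,$$ where $\ell$ is Lebesgue measure. Consider the model $$y_{t+1}=\theta^\tau\phi(y_t,\dots,y_{t-n+1})+w_{t+1},\quad t\ge 0,\qquad y_t=0\ \text{ for } t<0,$$ where $y_0$ is a (possibly random) initial value. Put $Y_t=(y_{t+n-1},\dots,y_t)^\tau$, $N_t(M)=\#\{1\le i\le t:\|Y_i\|\le M\}$ and $\Omega(M)=\{\lim_{t\to\infty}N_t(M)=+\infty\}$. For regressors $\phi_0,\phi_1,\dots\in\mathbb{R}^m$ let $\lambda_{\min}(t+1)$ be the smallest eigenvalue of $P_{t+1}^{-1}=I_m+\sum_{i=0}^{t}\phi_i\phi_i^\tau$. (1) Random parameter. Suppose that $w_1,w_2,\dots$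 are i.i.d. $N(0,1)$, $\theta\sim N(\theta_0,I_m)$, and $(\theta,y_0)$ is independent of $\{w_t\}_{t\ge1}$. Let $\phi_t=\phi(y_t,\dots,y_{t-n+1})$. Then for every $M>0$, $$\liminf_{t\to\infty}\frac{\lambda_{\min}(t+1)}{N_t(M)}>0\quad\text{a.s. on }\Omega(M).$$ (2) Constant parameter. There is a constant $M_\phi>0$ depending only on $\phi$ with the following property. Suppose that $\theta\in\mathbb{R}^m$ is non-random, and that $w_1,w_2,\dots$ are i.i.d. and independent of $y_0$, with $\mathbb{E}w_1=0$, $\mathbb{E}|w_1|^\beta<\infty$ for some $\beta>2$, and a density $\rho$ such that $\sup_{x\in\mathbb{R}}\rho(x)<\infty$ and $\inf_{x\in I}\rho(x)>0$ for every bounded interval $I$. Let $C_\phi>M_\phi$, $M>0$, and let $\phi_t=\phi(y_t,\dots,y_{t-n+1})$ if $\|Y_{t-n+1}\|\le C_\phi$ and $\phi_t=0$ otherwise. Then $$\liminf_{t\to\infty}\frac{\lambda_{\min}(t+1)}{N_t(M)}>0\quad\text{a.s. on }\Omega(M).$$ If moreover $M\ge C_\phi$, then the least squares estimates defined by $\hat\theta_{t+1}=\hat\theta_t+P_{t+1}\phi_t(y_{t+1}-\phi_t^\tau\hat\theta_t)$,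 $P_{t+1}=P_t-(1+\phi_t^\tau P_t\phi_t)^{-1}P_t\phi_t\phi_t^\tau P_t$, $P_0=I_m$, with any deterministic $\hat\theta_0$, satisfy $$\|\hat\theta_t-\theta\|^2=O\!\left(\frac{\log N_t(M)}{N_t(M)}\right)\quad\text{a.s. on }\Omega(M).$$ -/

import Mathlib

open MeasureTheory ProbabilityTheory Filter Asymptotics Matrix

noncomputable section

namespace NAR

/-! ### Jordan measure zero, and the level set condition on the regression function -/

/-- `S` has Jordan measure (Jordan content) zero: for every `ε > 0` it is covered by finitely
many boxes of total volume less than `ε`. -/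
def JordanNull {n : ℕ} (S : Set (EuclideanSpace ℝ (Fin n))) : Prop :=
  ∀ ε : ℝ, 0 < ε → ∃ (k : ℕ) (a b : Fin k → Fin n → ℝ),
    (∀ j i, a j i ≤ b j i) ∧
    S ⊆ ⋃ j, {z | ∀ i, a j i ≤ z i ∧ z i ≤ b j i} ∧
    ∑ j, ∏ i, (b j i - a j i) < ε

/-- The hypothesis on `φ : ℝⁿ → ℝᵐ`: all coordinates are continuous, and for some bounded open
`E` and some `δ > 0` the level sets `{y ∈ closure E : |φ(y)ᵀ x| = δ}` have Jordan measure zero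
for all unit vectors `x`, while the Lebesgue measure of `{y ∈ E : |φ(y)ᵀ x| > δ}` is bounded
below uniformly in `x`. -/
def LevelSetCondition {n m : ℕ}
    (φ : EuclideanSpace ℝ (Fin n) → EuclideanSpace ℝ (Fin m)) : Prop :=
  ∃ (E : Set (EuclideanSpace ℝ (Fin n))) (δ : ℝ),
    IsOpen E ∧ Bornology.IsBounded E ∧ 0 < δ ∧
    (∀ i, Continuous fun z => φ z i) ∧
    (∀ x : EuclideanSpace ℝ (Fin m), ‖x‖ = 1 →
      JordanNull {y | y ∈ closure E ∧ |inner ℝ (φ y) x| = δ}) ∧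
    0 < ⨅ x : Metric.sphere (0 : EuclideanSpace ℝ (Fin m)) 1,
      volume {y | y ∈ E ∧ δ < |inner ℝ (φ y) (x : EuclideanSpace ℝ (Fin m))|}

/-! ### The autoregressive model -/

/-- `Y_t = (y_{t+n-1}, …, y_t)` along a path `y`. Thus `(y_t, …, y_{t-n+1})` is
`window n y (t - n + 1)`. -/
def window (n : ℕ) (y : ℤ → ℝ) (t : ℤ) : EuclideanSpace ℝ (Fin n) :=
  WithLp.toLp 2 fun j : Fin n => y (t + n - 1 - (j : ℤ))

/-- `φ(y_t, …, y_{t-n+1})` along a path `y`. -/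
def regressor {n m : ℕ} (φ : EuclideanSpace ℝ (Fin n) → EuclideanSpace ℝ (Fin m))
    (y : ℤ → ℝ) (t : ℕ) : EuclideanSpace ℝ (Fin m) :=
  φ (window n y ((t : ℤ) - n + 1))

open Classical in
/-- The regressor kept only when `‖Y_{t-n+1}‖ ≤ C`, and replaced by `0` otherwise. -/
def truncRegressor {n m : ℕ} (φ : EuclideanSpace ℝ (Fin n) → EuclideanSpace ℝ (Fin m))
    (C : ℝ) (y : ℤ → ℝ) (t : ℕ) : EuclideanSpace ℝ (Fin m) :=
  if ‖window n y ((t : ℤ) - n + 1)‖ ≤ C then regressor φ y t else 0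

/-- `y_{t+1} = θᵀ φ(y_t, …, y_{t-n+1}) + w_{t+1}` for `t ≥ 0`, with `y_t = 0` for `t < 0`. The
initial value `y_0` is a random variable, and only `w_1, w_2, …` are used. -/
structure IsModel {n m : ℕ} {Ω : Type*}
    (φ : EuclideanSpace ℝ (Fin n) → EuclideanSpace ℝ (Fin m))
    (θ : Ω → EuclideanSpace ℝ (Fin m)) (w : ℕ → Ω → ℝ) (y : ℤ → Ω → ℝ) : Prop where
  past : ∀ t : ℤ, t < 0 → ∀ ω, y t ω = 0
  step : ∀ (t : ℕ) (ω : Ω),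
    y ((t : ℤ) + 1) ω = inner ℝ (θ ω) (regressor φ (fun s => y s ω) t) + w (t + 1) ω

open Classical in
/-- `N_t(M)`, the number of `i ∈ {1, …, t}` with `‖Y_i‖ ≤ M`. -/
def visits (n : ℕ) (M : ℝ) (y : ℤ → ℝ) (t : ℕ) : ℕ :=
  ((Finset.Icc 1 t).filter fun i : ℕ => ‖window n y (i : ℤ)‖ ≤ M).card

/-! ### Least squares -/

/-- The matrices `P_t` of the recursive least squares algorithm with regressors `ψ`. -/
def gain {m : ℕ} (ψ : ℕ → EuclideanSpace ℝ (Fin m)) : ℕ → Matrix (Fin m) (Fin m) ℝ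
  | 0 => 1
  | t + 1 =>
    gain ψ t - (1 + (ψ t).ofLp ⬝ᵥ (gain ψ t *ᵥ (ψ t).ofLp))⁻¹ •
      (gain ψ t * vecMulVec (ψ t).ofLp (ψ t).ofLp * gain ψ t)

/-- The recursive least squares estimates, with initial value `θ₀`, regressors `ψ` and outputs
`y`. -/
def lsEstimate {m : ℕ} (θ₀ : EuclideanSpace ℝ (Fin m)) (ψ : ℕ → EuclideanSpace ℝ (Fin m))
    (y : ℤ → ℝ) : ℕ → EuclideanSpace ℝ (Fin m)
  | 0 => θ₀
  | t + 1 =>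
    lsEstimate θ₀ ψ y t + (y ((t : ℤ) + 1) - inner ℝ (ψ t) (lsEstimate θ₀ ψ y t)) •
      WithLp.toLp 2 (gain ψ (t + 1) *ᵥ (ψ t).ofLp)

/-- `infoMatrix ψ t = I + ∑_{i < t} ψ_i ψ_iᵀ`; this is the inverse of `gain ψ t`, see
`infoMatrix_eq_inv` below. -/
def infoMatrix {m : ℕ} (ψ : ℕ → EuclideanSpace ℝ (Fin m)) (t : ℕ) : Matrix (Fin m) (Fin m) ℝ :=
  1 + ∑ i ∈ Finset.range t, vecMulVec (ψ i).ofLp (ψ i).ofLp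

/-- The smallest real eigenvalue of a matrix. -/
def minEigenvalue {m : ℕ} (A : Matrix (Fin m) (Fin m) ℝ) : ℝ :=
  sInf {μ : ℝ | Module.End.HasEigenvalue (Matrix.toLin' A) μ}

/-- `λ_min(t)`, the smallest eigenvalue of `I + ∑_{i < t} ψ_i ψ_iᵀ`. -/
def lamMin {m : ℕ} (ψ : ℕ → EuclideanSpace ℝ (Fin m)) (t : ℕ) : ℝ :=
  minEigenvalue (infoMatrix ψ t)

theorem posDef_infoMatrix {m : ℕ} (ψ : ℕ → EuclideanSpace ℝ (Fin m)) (t : ℕ) :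
    (infoMatrix ψ t).PosDef := by
  unfold infoMatrix
  refine Matrix.PosDef.one.add_posSemidef (Matrix.posSemidef_sum _ fun i _ => ?_)
  simpa using Matrix.posSemidef_vecMulVec_self_star (ψ i).ofLp

theorem gain_mul_infoMatrix {m : ℕ} (ψ : ℕ → EuclideanSpace ℝ (Fin m)) (t : ℕ) :
    gain ψ t * infoMatrix ψ t = 1 := by
  induction t with
  | zero => simp [gain, infoMatrix]
  | succ t ih =>
    have hinv : gain ψ t = (infoMatrix ψ t)⁻¹ := (Matrix.inv_eq_left_inv ih).symm
    have hpos : (gain ψ t).PosDef := hinv ▸ (posDef_infoMatrix ψ t).inv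
    set v := (ψ t).ofLp with hv
    have hq : 0 ≤ v ⬝ᵥ (gain ψ t *ᵥ v) := by
      simpa using hpos.posSemidef.dotProduct_mulVec_nonneg v
    have hI : infoMatrix ψ (t + 1) = infoMatrix ψ t + vecMulVec v v := by
      simp [infoMatrix, Finset.sum_range_succ, add_assoc, hv]
    have hkey : vecMulVec v v * gain ψ t * vecMulVec v v
        = (v ⬝ᵥ (gain ψ t *ᵥ v)) • vecMulVec v v := by
      rw [Matrix.mul_assoc, Matrix.mul_vecMulVec, Matrix.vecMulVec_mul_vecMulVec]
      ext i j
      simp [vecMulVec_apply]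
      ring
    have hne : 1 + v ⬝ᵥ (gain ψ t *ᵥ v) ≠ 0 := by positivity
    have h2 : gain ψ t * vecMulVec v v * gain ψ t * infoMatrix ψ (t + 1)
        = (1 + v ⬝ᵥ (gain ψ t *ᵥ v)) • (gain ψ t * vecMulVec v v) := by
      rw [hI, Matrix.mul_add, Matrix.mul_assoc _ (gain ψ t) (infoMatrix ψ t), ih, Matrix.mul_one,
        Matrix.mul_assoc (gain ψ t), Matrix.mul_assoc (gain ψ t), hkey, Matrix.mul_smul,
        add_smul, one_smul]
    rw [gain, Matrix.sub_mul, Matrix.smul_mul, ← hv, h2, smul_smul, inv_mul_cancel₀ hne, one_smul,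
      hI, Matrix.mul_add, ih]
    simp

theorem infoMatrix_eq_inv {m : ℕ} (ψ : ℕ → EuclideanSpace ℝ (Fin m)) (t : ℕ) :
    infoMatrix ψ t = (gain ψ t)⁻¹ :=
  (Matrix.inv_eq_right_inv (gain_mul_infoMatrix ψ t)).symm

/-! ### The two settings -/

/-- Random parameter: `w_1, w_2, …` are i.i.d. `N(0,1)`, `θ ~ N(μ₀, I)`, and `(θ, y_0)` is
independent of the noise. -/
structure BayesianSetting {m : ℕ} {Ω : Type*} [MeasurableSpace Ω] (P : Measure Ω)
    (μ₀ : EuclideanSpace ℝ (Fin m)) (θ : Ω → EuclideanSpace ℝ (Fin m))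
    (w : ℕ → Ω → ℝ) (y : ℤ → Ω → ℝ) : Prop where
  measurable_noise : ∀ t : ℕ, Measurable (w (t + 1))
  measurable_init : Measurable (y 0)
  measurable_param : Measurable θ
  iIndep_noise : iIndepFun (fun t : ℕ => w (t + 1)) P
  law_noise : ∀ t : ℕ, P.map (w (t + 1)) = gaussianReal 0 1
  law_param : P.map θ = multivariateGaussian μ₀ 1
  indep : IndepFun (fun ω => (θ ω, y 0 ω)) (fun ω => fun t : ℕ => w (t + 1) ω) P

/-- Constant parameter: `w_1, w_2, …` are i.i.d. with mean zero, a finite absolute moment of some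
order `β > 2`, and a bounded density that is bounded away from zero on every bounded interval;
`y_0` is independent of the noise. -/
structure ConstantSetting {Ω : Type*} [MeasurableSpace Ω] (P : Measure Ω)
    (w : ℕ → Ω → ℝ) (y : ℤ → Ω → ℝ) : Prop where
  measurable_noise : ∀ t : ℕ, Measurable (w (t + 1))
  measurable_init : Measurable (y 0)
  iIndep_noise : iIndepFun (fun t : ℕ => w (t + 1)) P
  identDistrib_noise : ∀ t : ℕ, IdentDistrib (w (t + 1)) (w 1) P P
  mean_noise : ∫ ω, w 1 ω ∂P = 0
  moment_noise : ∃ β : ℝ, 2 < β ∧ Integrable (fun ω => |w 1 ω| ^ β) P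
  density_noise : ∃ ρ : ℝ → ℝ, Measurable ρ ∧ (∀ x, 0 ≤ ρ x) ∧
    P.map (w 1) = volume.withDensity (fun x => ENNReal.ofReal (ρ x)) ∧
    (∀ a b : ℝ, a < b → ∃ c : ℝ, 0 < c ∧ ∀ x ∈ Set.Icc a b, c ≤ ρ x) ∧
    ∃ C : ℝ, ∀ x, ρ x ≤ C
  indep : IndepFun (y 0) (fun ω => fun t : ℕ => w (t + 1) ω) P

end NAR

end

noncomputable section

namespace NAR

open scoped ENNReal

/-! ### Independence and the maximal inequality -/

section Probability

variable {Ω : Type*} {mΩ : MeasurableSpace Ω} {P : Measure Ω}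

/-! Excitation. Suppose `‖Y_i‖ ≤ M` and `‖θ‖ ≤ R`. Each of the next `n` outputs is a known shift
plus fresh noise, and the shift stays bounded as long as the new outputs stay in a fixed cube. The
noise law dominates a multiple of Lebesgue measure on bounded intervals, so the conditional law of
`Y_{i+n}` dominates a multiple of Lebesgue measure on the cube (`IsModel.lintegral_block_ge`). Hence
`Y_{i+n}` falls in `{z ∈ E : δ < |φ(z)ᵀx|}` with conditional probability bounded below. An
exponential supermartingale turns this into a positive proportion of the visits, almost surely
(`ae_exists_forall_hits_le`). By compactness of the unit sphere finitely many directions suffice, at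
the price of replacing `δ` by `δ / 2`. So `∑ (ψ_jᵀx)² ≥ κ N_t(M) - C` uniformly in unit `x`
(`IsModel.ae_sum_inner_sq_ge`), which bounds the smallest eigenvalue. The parameter enters only as
an `ℱ 0`-measurable quantity, so one argument serves the random and the constant case; truncation is
harmless once its radius exceeds that of a ball containing `E`.

Least squares. The recursion gives `P_t⁻¹(θ̂_t - θ) = θ̂_0 - θ + ∑ w_{i+1} ψ_i`. As `P_t⁻¹` grows
like `N_t(M)`, it remains to see that the noise sum is `O(√(N log N))`. The sum is measured on the
random clock that ticks when a regressor is kept (`IsAdaptedNoise.ae_sum_le`): truncate the noise at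
`√(k / log k)`, apply the maximal inequality to an exponential supermartingale for each `k`, and
conclude by Borel–Cantelli. A moment of order above `2` makes the truncation eventually inactive.

Conditional expectations are expressed throughout as inequalities between integrals over events, or
against weights, of the present. -/

theorem indepFun_prodMk_left_of_indepFun_prodMk_right [IsProbabilityMeasure P] {α β γ : Type*}
    [MeasurableSpace α] [MeasurableSpace β] [MeasurableSpace γ]
    {U : Ω → α} {V : Ω → β} {W : Ω → γ} (hU : Measurable U) (hV : Measurable V)
    (hW : Measurable W) (h : IndepFun U (fun ω => (V ω, W ω)) P) (hVW : IndepFun V W P) :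
    IndepFun (fun ω => (U ω, V ω)) W P := by
  have := Measure.isProbabilityMeasure_map (μ := P) hU.aemeasurable
  have := Measure.isProbabilityMeasure_map (μ := P) hV.aemeasurable
  have := Measure.isProbabilityMeasure_map (μ := P) hW.aemeasurable
  have hUV : IndepFun U V P := h.comp measurable_id measurable_fst
  rw [indepFun_iff_map_prod_eq_prod_map_map (by fun_prop) (by fun_prop)] at *
  rw [hUV]
  apply MeasurableEquiv.prodAssoc.map_measurableEquiv_injective
  rw [Measure.prodAssoc_prod, ← hVW, ← h,
    Measure.map_map (MeasurableEquiv.measurable _) (by fun_prop)]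
  rfl

/-- A nonnegative process whose integrals over events of the present do not increase. -/
def IsNonincreasingOnAverage (P : Measure Ω) (ℱ : Filtration ℕ mΩ) (X : ℕ → Ω → ℝ≥0∞) : Prop :=
  (∀ t, Measurable[ℱ t] (X t)) ∧
    ∀ t A, MeasurableSet[ℱ t] A → ∫⁻ ω in A, X (t + 1) ω ∂P ≤ ∫⁻ ω in A, X t ω ∂P

/-- The maximal inequality for nonnegative supermartingales. -/
theorem IsNonincreasingOnAverage.mul_measure_exists_le {ℱ : Filtration ℕ mΩ} {X : ℕ → Ω → ℝ≥0∞}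
    (h : IsNonincreasingOnAverage P ℱ X) (a : ℝ≥0∞) :
    a * P {ω | ∃ t, a ≤ X t ω} ≤ ∫⁻ ω, X 0 ω ∂P := by
  obtain ⟨hX, hstep⟩ := h
  set B : ℕ → Set Ω := fun t => {ω | ∀ s ≤ t, X s ω < a} with hB
  have hBm : ∀ t, MeasurableSet[ℱ t] (B t) := by
    intro t
    have : B t = ⋂ s ∈ Set.Iic t, {ω | X s ω < a} := by ext; simp [hB]
    rw [this]
    refine MeasurableSet.biInter (Set.to_countable _) fun s hs => ?_
    exact ((hX s).mono (ℱ.mono hs) le_rfl) measurableSet_Iio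
  have hBm' : ∀ t, MeasurableSet (B t) := fun t => ℱ.le t _ (hBm t)
  have hXm : ∀ t, Measurable (X t) := fun t => (hX t).mono (ℱ.le t) le_rfl
  -- Stopping at the first passage above `a`: mass that has left `B` is counted at value at least
  -- `a`, and mass still in `B` does not increase on average.
  have key : ∀ t, a * P (B t)ᶜ + ∫⁻ ω in B t, X t ω ∂P ≤ ∫⁻ ω, X 0 ω ∂P := by
    intro t
    induction t with
    | zero =>
      rw [← lintegral_add_compl (μ := P) (fun ω => X 0 ω) (hBm' 0)]
      refine (add_comm _ _).trans_le (add_le_add le_rfl ?_)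
      rw [← setLIntegral_const]
      refine setLIntegral_mono (hXm 0) fun ω hω => ?_
      simpa [hB] using hω
    | succ t ih =>
      refine le_trans ?_ ih
      have hsub : B (t + 1) ⊆ B t := fun ω hω s hs => hω s (hs.trans t.le_succ)
      have h1 : (B (t + 1))ᶜ = (B t)ᶜ ∪ (B t \ B (t + 1)) := by
        ext ω; have := @hsub ω; simp only [Set.mem_compl_iff, Set.mem_union, Set.mem_sdiff]; tauto
      have h2 : P (B (t + 1))ᶜ = P (B t)ᶜ + P (B t \ B (t + 1)) := by
        rw [h1, measure_union _ ((hBm' t).diff (hBm' (t + 1)))]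
        exact Set.disjoint_left.2 fun ω h h' => h h'.1
      have h3 := hstep t (B t) (hBm t)
      have h4 : ∫⁻ ω in B t, X (t + 1) ω ∂P
          = ∫⁻ ω in B (t + 1), X (t + 1) ω ∂P + ∫⁻ ω in B t \ B (t + 1), X (t + 1) ω ∂P := by
        rw [← lintegral_inter_add_sdiff _ (B t) (hBm' (t + 1)), Set.inter_eq_right.2 hsub]
      have h5 : a * P (B t \ B (t + 1)) ≤ ∫⁻ ω in B t \ B (t + 1), X (t + 1) ω ∂P := by
        rw [← setLIntegral_const]
        refine setLIntegral_mono (hXm _) fun ω hω => ?_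
        by_contra! hlt
        refine hω.2 fun s hs => ?_
        rcases Nat.le_succ_iff.1 hs with hs | rfl
        · exact hω.1 s hs
        · exact hlt
      calc a * P (B (t + 1))ᶜ + ∫⁻ ω in B (t + 1), X (t + 1) ω ∂P
          = a * P (B t)ᶜ + (∫⁻ ω in B (t + 1), X (t + 1) ω ∂P + a * P (B t \ B (t + 1))) := by
            rw [h2]; ring
        _ ≤ a * P (B t)ᶜ + ∫⁻ ω in B t, X t ω ∂P := by
            gcongr
            refine le_trans ?_ h3
            rw [h4]
            gcongr
  have hU : {ω | ∃ t, a ≤ X t ω} = ⋃ t, (B t)ᶜ := by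
    ext ω
    simp only [hB, Set.mem_ofPred_eq, Set.mem_iUnion, Set.mem_compl_iff, not_forall, not_lt]
    exact ⟨fun ⟨t, h⟩ => ⟨t, t, le_rfl, h⟩, fun ⟨_, s, _, h⟩ => ⟨s, h⟩⟩
  have hmono : Monotone fun t => (B t)ᶜ := by
    intro s t hst
    exact Set.compl_subset_compl.2 fun ω hω r hr => hω r (hr.trans hst)
  rw [hU, hmono.measure_iUnion, ENNReal.mul_iSup]
  exact iSup_le fun t => le_trans le_self_add (key t)

/-- Unboundedness means that every level `a` is reached, so its probability is at most `(∫ X 0) / a`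
for every `a`. -/
theorem IsNonincreasingOnAverage.ae_exists_forall_lt {ℱ : Filtration ℕ mΩ} {X : ℕ → Ω → ℝ≥0∞}
    (h : IsNonincreasingOnAverage P ℱ X) (h0 : ∫⁻ ω, X 0 ω ∂P ≠ ∞) :
    ∀ᵐ ω ∂P, ∃ a : ℕ, ∀ t, X t ω < a := by
  rw [ae_iff]
  have hle : ∀ a : ℕ, (a : ℝ≥0∞) * P {ω | ¬ ∃ a : ℕ, ∀ t, X t ω < a} ≤ ∫⁻ ω, X 0 ω ∂P := by
    intro a
    refine le_trans ?_ (h.mul_measure_exists_le (a : ℝ≥0∞))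
    gcongr with ω
    intro hω
    push Not at hω
    exact hω a
  by_contra hne
  obtain ⟨k, hk⟩ := ENNReal.exists_nat_mul_gt hne h0
  exact absurd (hle k) (not_le.2 hk)

/-- `w_1, w_2, …` is adapted to `ℱ`, with `w_{t+1}` independent of `ℱ t` and of law `μ`. -/
structure IsAdaptedNoise (P : Measure Ω) (ℱ : Filtration ℕ mΩ) (w : ℕ → Ω → ℝ)
    (μ : Measure ℝ) : Prop where
  measurable : ∀ t, Measurable[ℱ (t + 1)] (w (t + 1))
  indep : ∀ t, Indep (ℱ t) (MeasurableSpace.comap (w (t + 1)) inferInstance) P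
  law : ∀ t, P.map (w (t + 1)) = μ

/-- The freezing lemma: `Z` is independent of `w (t + 1)`, so their joint law is a product and
Tonelli integrates the noise out with `Z` held fixed. It plays the role of conditioning on `ℱ t`. -/
theorem IsAdaptedNoise.lintegral_comp [IsProbabilityMeasure P] {ℱ : Filtration ℕ mΩ}
    {w : ℕ → Ω → ℝ} {μ : Measure ℝ} (hw : IsAdaptedNoise P ℱ w μ) (t : ℕ) {β : Type*}
    [MeasurableSpace β] {Z : Ω → β} (hZ : Measurable[ℱ t] Z) {H : β → ℝ → ℝ≥0∞}
    (hH : Measurable (Function.uncurry H)) :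
    ∫⁻ ω, H (Z ω) (w (t + 1) ω) ∂P = ∫⁻ ω, ∫⁻ x, H (Z ω) x ∂μ ∂P := by
  have hZ' : Measurable Z := hZ.mono (ℱ.le t) le_rfl
  have hw' : Measurable (w (t + 1)) := (hw.measurable t).mono (ℱ.le _) le_rfl
  have hind : IndepFun Z (w (t + 1)) P :=
    indep_of_indep_of_le_left (hw.indep t) hZ.comap_le
  have hp : IsProbabilityMeasure μ := by
    rw [← hw.law t]; exact Measure.isProbabilityMeasure_map hw'.aemeasurable
  have h1 := (indepFun_iff_map_prod_eq_prod_map_map hZ'.aemeasurable hw'.aemeasurable).1 hind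
  have := Measure.isProbabilityMeasure_map (μ := P) hZ'.aemeasurable
  calc ∫⁻ ω, H (Z ω) (w (t + 1) ω) ∂P
      = ∫⁻ p, Function.uncurry H p ∂(P.map fun ω => (Z ω, w (t + 1) ω)) := by
        rw [lintegral_map hH (by fun_prop)]; rfl
    _ = ∫⁻ z, ∫⁻ x, H z x ∂μ ∂(P.map Z) := by
        rw [h1, hw.law, lintegral_prod _ hH.aemeasurable]; rfl
    _ = _ := lintegral_map (f := fun z => ∫⁻ x, H z x ∂μ) hH.lintegral_prod_right' hZ'

/-- The filtration is generated by `U` and the first `t` noises. Here `U` collects the initial data,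
so everything random at time `0` is `ℱ 0`-measurable. -/
theorem exists_isAdaptedNoise [IsProbabilityMeasure P] {β : Type*} [MeasurableSpace β] {U : Ω → β}
    {w : ℕ → Ω → ℝ} {μ : Measure ℝ} (hU : Measurable U) (hw : ∀ t : ℕ, Measurable (w (t + 1)))
    (hind : iIndepFun (fun t : ℕ => w (t + 1)) P) (hlaw : ∀ t, P.map (w (t + 1)) = μ)
    (hUw : IndepFun U (fun ω => fun t : ℕ => w (t + 1) ω) P) :
    ∃ ℱ : Filtration ℕ mΩ, IsAdaptedNoise P ℱ w μ ∧ Measurable[ℱ 0] U := by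
  let V : (t : ℕ) → Ω → (Finset.range t → ℝ) := fun t ω i => w (i + 1) ω
  have hV : ∀ t, Measurable (V t) := fun t => measurable_pi_lambda _ fun i => hw i
  let ℱ : Filtration ℕ mΩ :=
    { seq := fun t => MeasurableSpace.comap (fun ω => (U ω, V t ω)) inferInstance
      mono' := by
        intro s t hst
        have : (fun ω => (U ω, V s ω)) = (fun p : β × (Finset.range t → ℝ) =>
          (p.1, fun i : Finset.range s =>
            p.2 ⟨i, Finset.mem_range.2 ((Finset.mem_range.1 i.2).trans_le hst)⟩)) ∘
            (fun ω => (U ω, V t ω)) := rfl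
        simp only
        rw [this, ← MeasurableSpace.comap_comp]
        refine MeasurableSpace.comap_mono (Measurable.comap_le ?_)
        fun_prop
      le' := fun t => (hU.prodMk (hV t)).comap_le }
  have hcom : ∀ t, Measurable[ℱ t] fun ω => (U ω, V t ω) := fun t => comap_measurable _
  refine ⟨ℱ, ⟨fun t => ?_, fun t => ?_, hlaw⟩, ?_⟩
  · exact Measurable.comp (g := fun p : β × (Finset.range (t + 1) → ℝ) =>
      p.2 ⟨t, by simp⟩) (by fun_prop) (hcom (t + 1))
  · have h1 : IndepFun (V t) (w (t + 1)) P := by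
      have := hind.indepFun_finset (Finset.range t) {t} (by simp) hw
      exact this.comp (φ := id) (ψ := fun p : (({t} : Finset ℕ) → ℝ) => p ⟨t, by simp⟩)
        measurable_id (by fun_prop)
    have h2 : IndepFun U (fun ω => (V t ω, w (t + 1) ω)) P :=
      hUw.comp (φ := id) (ψ := fun p : ℕ → ℝ =>
        ((fun i : Finset.range t => p i : Finset.range t → ℝ), p t)) measurable_id (by fun_prop)
    exact indepFun_prodMk_left_of_indepFun_prodMk_right hU (hV t) (hw t) h2 h1
  · exact measurable_fst.comp (hcom 0)

end Probability

/-! ### Counting occurrences of events -/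

section Counting

variable {Ω : Type*} {mΩ : MeasurableSpace Ω} {P : Measure Ω}

open Classical in
/-- The number of `i < t` for which `D i` occurs. -/
def hits (D : ℕ → Set Ω) (t : ℕ) (ω : Ω) : ℕ := Nat.count (fun i => ω ∈ D i) t

theorem hits_zero (D : ℕ → Set Ω) (ω : Ω) : hits D 0 ω = 0 := by
  classical
  exact Nat.count_zero _

theorem hits_succ_of_mem {D : ℕ → Set Ω} {t : ℕ} {ω : Ω} (h : ω ∈ D t) :
    hits D (t + 1) ω = hits D t ω + 1 := by
  classical
  simp [hits, Nat.count_succ, h]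

theorem hits_succ_of_notMem {D : ℕ → Set Ω} {t : ℕ} {ω : Ω} (h : ω ∉ D t) :
    hits D (t + 1) ω = hits D t ω := by
  classical
  simp [hits, Nat.count_succ, h]

theorem hits_mono (D : ℕ → Set Ω) (ω : Ω) : Monotone fun t => hits D t ω := by
  classical
  exact Nat.count_monotone _

theorem hits_le_hits {D D' : ℕ → Set Ω} {t : ℕ} {ω : Ω} (h : ∀ i < t, ω ∈ D i → ω ∈ D' i) :
    hits D t ω ≤ hits D' t ω := by
  induction t with
  | zero => simp [hits_zero]
  | succ t ih =>
    have ih' := ih fun i hi => h i (hi.trans t.lt_succ_self)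
    by_cases hd : ω ∈ D t
    · rw [hits_succ_of_mem hd, hits_succ_of_mem (h t t.lt_succ_self hd)]
      lia
    · rw [hits_succ_of_notMem hd]
      exact ih'.trans (hits_mono D' ω t.le_succ)

theorem measurable_hits {ℱ : Filtration ℕ mΩ} {D : ℕ → Set Ω} {s : ℕ}
    (t : ℕ) (hD : ∀ i < t, MeasurableSet[ℱ s] (D i)) : Measurable[ℱ s] (hits D t) := by
  classical
  induction t with
  | zero => exact (measurable_const : Measurable[ℱ s] fun _ : Ω => (0 : ℕ))
  | succ t ih =>
    have : hits D (t + 1) = fun ω => hits D t ω + if ω ∈ D t then 1 else 0 := by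
      ext ω; exact Nat.count_succ _ _
    rw [this]
    exact Measurable.add (ih fun i hi => hD i (hi.trans t.lt_succ_self))
      (Measurable.ite (hD t t.lt_succ_self) measurable_const measurable_const)

/-- One step of the supermartingale below: `a` is the mass where the favourable event occurs, `b`
the rest. The hypothesis gives `a / 2 + b ≤ (1 - κ / 2)(a + b)`, and `1 - κ / 2 ≤ exp (-κ / 2)`. -/
theorem exp_half_mul_le {κ : ℝ} (hκ : 0 ≤ κ) {a b : ℝ≥0∞} (h : ENNReal.ofReal κ * (a + b) ≤ a) :
    ENNReal.ofReal (Real.exp (κ / 2)) * (a / 2 + b) ≤ a + b := by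
  by_cases ha : a = ∞
  · simp [ha]
  by_cases hb : b = ∞
  · simp [hb]
  obtain ⟨x, hx, rfl⟩ : ∃ x : ℝ, 0 ≤ x ∧ a = ENNReal.ofReal x :=
    ⟨a.toReal, ENNReal.toReal_nonneg, (ENNReal.ofReal_toReal ha).symm⟩
  obtain ⟨y, hy, rfl⟩ : ∃ x : ℝ, 0 ≤ x ∧ b = ENNReal.ofReal x :=
    ⟨b.toReal, ENNReal.toReal_nonneg, (ENNReal.ofReal_toReal hb).symm⟩
  have h2 : (2 : ℝ≥0∞) = ENNReal.ofReal 2 := by simp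
  rw [← ENNReal.ofReal_add hx hy, ← ENNReal.ofReal_mul hκ, ENNReal.ofReal_le_ofReal_iff hx] at h
  rw [h2, ← ENNReal.ofReal_div_of_pos two_pos, ← ENNReal.ofReal_add (by positivity) hy,
    ← ENNReal.ofReal_add hx hy, ← ENNReal.ofReal_mul (Real.exp_pos _).le]
  refine ENNReal.ofReal_le_ofReal ?_
  have h3 : x / 2 + y ≤ (1 - κ / 2) * (x + y) := by linarith
  have h4 : 1 - κ / 2 ≤ Real.exp (-(κ / 2)) := by linarith [Real.add_one_le_exp (-(κ / 2))]
  calc Real.exp (κ / 2) * (x / 2 + y)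
      ≤ Real.exp (κ / 2) * (Real.exp (-(κ / 2)) * (x + y)) := by
        gcongr
        exact h3.trans (by gcongr)
    _ = x + y := by rw [← mul_assoc, ← Real.exp_add]; simp

/-- If `A k` has conditional probability at least `κ` whenever `B k` occurs, then `B k ∩ A k`
occurs for a positive proportion of the `k` with `B k`. -/
theorem ae_exists_forall_hits_le [IsProbabilityMeasure P] {ℱ : Filtration ℕ mΩ}
    {A B : ℕ → Set Ω} {κ : ℝ} (hκ : 0 ≤ κ) (hB : ∀ k, MeasurableSet[ℱ k] (B k))
    (hA : ∀ k, MeasurableSet[ℱ (k + 1)] (A k))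
    (h : ∀ k (f : Ω → ℝ≥0∞), Measurable[ℱ k] f →
      ENNReal.ofReal κ * ∫⁻ ω in B k, f ω ∂P ≤ ∫⁻ ω in B k ∩ A k, f ω ∂P) :
    ∀ᵐ ω ∂P, ∃ C : ℝ, ∀ t,
      κ / 2 * hits B t ω ≤ Real.log 2 * hits (fun k => B k ∩ A k) t ω + C := by
  -- Each occurrence of `B` multiplies `X` by `exp (κ / 2)`, and a simultaneous `A` halves it; the
  -- halving compensates on average. Boundedness of `X` along a path is the claim.
  set X : ℕ → Ω → ℝ≥0∞ := fun t ω => ENNReal.ofReal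
    (Real.exp (κ / 2 * hits B t ω - Real.log 2 * hits (fun k => B k ∩ A k) t ω)) with hXdef
  have hBm : ∀ k, MeasurableSet (B k) := fun k => ℱ.le _ _ (hB k)
  have hAm : ∀ k, MeasurableSet (A k) := fun k => ℱ.le _ _ (hA k)
  have hXm : ∀ t, Measurable[ℱ t] (X t) := by
    intro t
    have h1 : Measurable[ℱ t] (hits B t) :=
      measurable_hits t fun i hi => ℱ.mono hi.le _ (hB i)
    have h2 : Measurable[ℱ t] (hits (fun k => B k ∩ A k) t) :=
      measurable_hits t fun i hi => (ℱ.mono hi.le _ (hB i)).inter (ℱ.mono hi _ (hA i))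
    have h3 : Measurable[ℱ t] fun ω => (hits B t ω, hits (fun k => B k ∩ A k) t ω) :=
      h1.prodMk h2
    have h4 : Measurable fun p : ℕ × ℕ => ENNReal.ofReal
      (Real.exp (κ / 2 * p.1 - Real.log 2 * p.2)) := Measurable.of_discrete
    have h5 := h4.comp h3
    simpa only [hXdef, Function.comp_def] using h5
  set c : ℝ≥0∞ := ENNReal.ofReal (Real.exp (κ / 2)) with hc
  have hstep : ∀ t ω, ω ∉ B t → X (t + 1) ω = X t ω := by
    intro t ω hω
    simp only [hXdef]
    rw [hits_succ_of_notMem hω, hits_succ_of_notMem fun h => hω h.1]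
  have hstep1 : ∀ t ω, ω ∈ B t ∩ A t → X (t + 1) ω = c * (X t ω / 2) := by
    intro t ω hω
    simp only [hXdef, hc]
    rw [hits_succ_of_mem hω.1, hits_succ_of_mem (D := fun k => B k ∩ A k) hω,
      show (2 : ℝ≥0∞) = ENNReal.ofReal 2 by simp, ← ENNReal.ofReal_div_of_pos two_pos,
      ← ENNReal.ofReal_mul (Real.exp_pos _).le]
    have h2 : ∀ x : ℝ, Real.exp x / 2 = Real.exp (x - Real.log 2) := fun x => by
      rw [Real.exp_sub, Real.exp_log two_pos]
    rw [h2, ← Real.exp_add]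
    push_cast
    ring_nf
  have hstep2 : ∀ t ω, ω ∈ B t \ A t → X (t + 1) ω = c * X t ω := by
    intro t ω hω
    simp only [hXdef, hc]
    rw [hits_succ_of_mem hω.1, hits_succ_of_notMem fun h => hω.2 h.2,
      ← ENNReal.ofReal_mul (Real.exp_pos _).le, ← Real.exp_add]
    push_cast
    ring_nf
  have hX : IsNonincreasingOnAverage P ℱ X := by
    refine ⟨hXm, fun t F hF => ?_⟩
    have hFm : MeasurableSet F := ℱ.le _ _ hF
    have hXt : Measurable (X t) := (hXm t).mono (ℱ.le t) le_rfl
    -- Weighting by `X` localised to `F` is what makes the bound a conditional one.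
    have hind := h t (F.indicator (X t)) ((hXm t).indicator hF)
    rw [setLIntegral_indicator hFm, setLIntegral_indicator hFm] at hind
    have hsplit : ∀ f : Ω → ℝ≥0∞, ∫⁻ ω in F, f ω ∂P = ∫⁻ ω in F ∩ (B t ∩ A t), f ω ∂P +
        ∫⁻ ω in F ∩ (B t \ A t), f ω ∂P + ∫⁻ ω in F \ B t, f ω ∂P := by
      intro f
      rw [← lintegral_inter_add_sdiff f F (hBm t),
        ← lintegral_inter_add_sdiff f (F ∩ B t) (hAm t), Set.inter_assoc, Set.inter_sdiff_assoc]
    have e0 : ∫⁻ ω in F ∩ B t, X t ω ∂P = ∫⁻ ω in F ∩ (B t ∩ A t), X t ω ∂P +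
        ∫⁻ ω in F ∩ (B t \ A t), X t ω ∂P := by
      rw [← lintegral_inter_add_sdiff _ (F ∩ B t) (hAm t), Set.inter_assoc,
        Set.inter_sdiff_assoc]
    rw [e0] at hind
    have e1 : ∫⁻ ω in F ∩ (B t ∩ A t), X (t + 1) ω ∂P
        = c * ((∫⁻ ω in F ∩ (B t ∩ A t), X t ω ∂P) / 2) := by
      rw [setLIntegral_congr_fun (hFm.inter ((hBm t).inter (hAm t)))
        (fun ω hω => hstep1 t ω hω.2), lintegral_const_mul _ (by fun_prop)]
      simp only [div_eq_mul_inv]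
      rw [lintegral_mul_const _ hXt]
    have e2 : ∫⁻ ω in F ∩ (B t \ A t), X (t + 1) ω ∂P
        = c * ∫⁻ ω in F ∩ (B t \ A t), X t ω ∂P := by
      rw [setLIntegral_congr_fun (hFm.inter ((hBm t).diff (hAm t)))
        (fun ω hω => hstep2 t ω hω.2), lintegral_const_mul _ hXt]
    have e3 : ∫⁻ ω in F \ B t, X (t + 1) ω ∂P = ∫⁻ ω in F \ B t, X t ω ∂P :=
      setLIntegral_congr_fun (hFm.diff (hBm t)) fun ω hω => hstep t ω hω.2
    rw [hsplit, hsplit (X t), e1, e2, e3, ← mul_add]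
    gcongr
    exact exp_half_mul_le hκ hind
  have h0 : ∫⁻ ω, X 0 ω ∂P ≠ ∞ := by simp [hXdef, hits_zero]
  filter_upwards [hX.ae_exists_forall_lt h0] with ω ⟨a, ha⟩
  refine ⟨a, fun t => ?_⟩
  have h1 := ha t
  simp only [hXdef] at h1
  rw [ENNReal.ofReal_lt_natCast (by rintro rfl; simp at h1)] at h1
  have h2 := Real.add_one_le_exp
    (κ / 2 * hits B t ω - Real.log 2 * hits (fun k => B k ∩ A k) t ω)
  linarith

end Counting

/-! ### Growth of weighted sums of the noise -/

section Growth

/-- `x` if `|x| ≤ T`, and `0` otherwise. -/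
def clip (T x : ℝ) : ℝ := (Set.Icc (-T) T).indicator id x

theorem clip_of_abs_le {T x : ℝ} (h : |x| ≤ T) : clip T x = x :=
  Set.indicator_of_mem (Set.mem_Icc.2 (abs_le.1 h)) _

theorem clip_of_lt_abs {T x : ℝ} (h : T < |x|) : clip T x = 0 :=
  Set.indicator_of_notMem (fun hx => absurd (abs_le.2 (Set.mem_Icc.1 hx)) (not_le.2 h)) _

theorem abs_clip_le {T : ℝ} (hT : 0 ≤ T) (x : ℝ) : |clip T x| ≤ T := by
  rcases le_or_gt |x| T with h | h
  · rwa [clip_of_abs_le h]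
  · simpa [clip_of_lt_abs h]

theorem measurable_clip (T : ℝ) : Measurable (clip T) :=
  measurable_id.indicator measurableSet_Icc

theorem exp_le_one_add_add_sq {x : ℝ} (h : |x| ≤ 1) : Real.exp x ≤ 1 + x + x ^ 2 := by
  have := (abs_le.1 (Real.abs_exp_sub_one_sub_id_le h)).2
  linarith

/-- Clipping at `1 / l` keeps the exponent in `[-1, 1]`, where `exp x ≤ 1 + x + x²`. The quadratic
term costs `l²` times the second moment. Clipping spoils the zero mean by at most `l` times the
second moment, since `|x| ≤ l x²` where `|x| > 1 / l`; this costs the same again, whence the factor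
`2`. -/
theorem lintegral_exp_mul_clip_le {μ : Measure ℝ} [IsProbabilityMeasure μ] (h0 : ∫ x, x ∂μ = 0)
    (h1 : Integrable (fun x => x) μ) (h2 : Integrable (fun x => x ^ 2) μ) {l v : ℝ} (hl : 0 < l)
    (hv : |v| ≤ 1) :
    ∫⁻ x, ENNReal.ofReal (Real.exp (l * (v * clip l⁻¹ x))) ∂μ ≤
      ENNReal.ofReal (Real.exp (2 * l ^ 2 * ∫ x, x ^ 2 ∂μ)) := by
  have hc1 : Integrable (fun x => clip l⁻¹ x) μ := h1.indicator measurableSet_Icc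
  have hclip : ∀ x, (clip l⁻¹ x) ^ 2 ≤ x ^ 2 := by
    intro x
    rcases le_or_gt |x| l⁻¹ with h | h
    · rw [clip_of_abs_le h]
    · rw [clip_of_lt_abs h, zero_pow two_ne_zero]; positivity
  have hdiff : ∀ x, |clip l⁻¹ x - x| ≤ l * x ^ 2 := by
    intro x
    rcases le_or_gt |x| l⁻¹ with h | h
    · rw [clip_of_abs_le h, sub_self, abs_zero]; positivity
    · rw [clip_of_lt_abs h, zero_sub, abs_neg, ← sq_abs]
      have : 1 ≤ l * |x| := by
        rw [inv_lt_iff_one_lt_mul₀ hl] at h; linarith [mul_comm l |x|]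
      nlinarith [abs_nonneg x]
  have hmean : |∫ x, clip l⁻¹ x ∂μ| ≤ l * ∫ x, x ^ 2 ∂μ := by
    calc |∫ x, clip l⁻¹ x ∂μ| = |∫ x, (clip l⁻¹ x - x) ∂μ| := by
          rw [integral_sub hc1 h1, h0, sub_zero]
      _ ≤ ∫ x, l * x ^ 2 ∂μ :=
          by
          rw [← Real.norm_eq_abs]
          exact norm_integral_le_of_norm_le (h2.const_mul l) (Eventually.of_forall hdiff)
      _ = _ := integral_const_mul _ _
  have hpt : ∀ x, Real.exp (l * (v * clip l⁻¹ x)) ≤ 1 + (l * v) * clip l⁻¹ x + l ^ 2 * x ^ 2 := by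
    intro x
    have habs : |l * (v * clip l⁻¹ x)| ≤ 1 := by
      rw [abs_mul, abs_mul, abs_of_pos hl]
      calc l * (|v| * |clip l⁻¹ x|) ≤ l * (1 * l⁻¹) := by
            gcongr; exact abs_clip_le (by positivity) x
        _ = 1 := by field_simp
    refine (exp_le_one_add_add_sq habs).trans ?_
    have hv2 : v ^ 2 ≤ 1 := by rw [← sq_abs]; exact pow_le_one₀ (abs_nonneg v) hv
    have : v ^ 2 * clip l⁻¹ x ^ 2 ≤ 1 * x ^ 2 :=
      mul_le_mul hv2 (hclip x) (sq_nonneg _) zero_le_one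
    nlinarith [sq_nonneg l]
  have hi : Integrable (fun x => 1 + (l * v) * clip l⁻¹ x + l ^ 2 * x ^ 2) μ :=
    ((integrable_const _).add (hc1.const_mul _)).add (h2.const_mul _)
  have hs : 0 ≤ ∫ x, x ^ 2 ∂μ := integral_nonneg fun x => sq_nonneg x
  calc ∫⁻ x, ENNReal.ofReal (Real.exp (l * (v * clip l⁻¹ x))) ∂μ
      ≤ ∫⁻ x, ENNReal.ofReal (1 + (l * v) * clip l⁻¹ x + l ^ 2 * x ^ 2) ∂μ :=
        lintegral_mono fun x => ENNReal.ofReal_le_ofReal (hpt x)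
    _ = ENNReal.ofReal (∫ x, (1 + (l * v) * clip l⁻¹ x + l ^ 2 * x ^ 2) ∂μ) :=
        (ofReal_integral_eq_lintegral_ofReal hi
          (Eventually.of_forall fun x => (Real.exp_pos _).le.trans (hpt x))).symm
    _ ≤ _ := by
        refine ENNReal.ofReal_le_ofReal ?_
        have hi1 : Integrable (fun x => 1 + (l * v) * clip l⁻¹ x) μ :=
          (integrable_const _).add (hc1.const_mul _)
        rw [integral_add hi1 (h2.const_mul _), integral_add (integrable_const _) (hc1.const_mul _),
          integral_const_mul, integral_const_mul]
        simp only [integral_const, probReal_univ, smul_eq_mul, mul_one]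
        have h3 : l * v * ∫ x, clip l⁻¹ x ∂μ ≤ l * (l * ∫ x, x ^ 2 ∂μ) := by
          refine (le_abs_self _).trans ?_
          rw [abs_mul, abs_mul, abs_of_pos hl]
          calc l * |v| * |∫ x, clip l⁻¹ x ∂μ| ≤ l * 1 * (l * ∫ x, x ^ 2 ∂μ) := by gcongr
            _ = _ := by ring
        linarith [Real.add_one_le_exp (2 * l ^ 2 * ∫ x, x ^ 2 ∂μ)]

variable {Ω : Type*} {mΩ : MeasurableSpace Ω} {P : Measure Ω}

/-- The compensator is charged only on `D`: elsewhere the weight vanishes and the exponent does not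
move. -/
theorem IsAdaptedNoise.isNonincreasingOnAverage_exp [IsProbabilityMeasure P]
    {ℱ : Filtration ℕ mΩ} {w : ℕ → Ω → ℝ} {μ : Measure ℝ} [IsProbabilityMeasure μ]
    (hw : IsAdaptedNoise P ℱ w μ) (h0 : ∫ x, x ∂μ = 0)
    (h1 : Integrable (fun x => x) μ) (h2 : Integrable (fun x => x ^ 2) μ)
    {u : ℕ → Ω → ℝ} (hu : ∀ t, Measurable[ℱ t] (u t)) {D : ℕ → Set Ω}
    (hD : ∀ t, MeasurableSet[ℱ t] (D t)) (huD : ∀ t ω, |u t ω| ≤ (D t).indicator 1 ω)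
    {l : ℝ} (hl : 0 < l) :
    IsNonincreasingOnAverage P ℱ fun t ω => ENNReal.ofReal (Real.exp
      (l * ∑ i ∈ Finset.range t, u i ω * clip l⁻¹ (w (i + 1) ω) -
        2 * l ^ 2 * (∫ x, x ^ 2 ∂μ) * hits D t ω)) := by
  set s := ∫ x, x ^ 2 ∂μ with hs
  have hXm : ∀ t, Measurable[ℱ t] fun ω => ENNReal.ofReal (Real.exp
      (l * ∑ i ∈ Finset.range t, u i ω * clip l⁻¹ (w (i + 1) ω) -
        2 * l ^ 2 * s * hits D t ω)) := by
    intro t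
    have a1 : Measurable[ℱ t] (hits D t) := measurable_hits t fun i hi => ℱ.mono hi.le _ (hD i)
    have a2 : Measurable[ℱ t] fun ω => ∑ i ∈ Finset.range t, u i ω * clip l⁻¹ (w (i + 1) ω) := by
      refine Finset.measurable_fun_sum _ fun i hi => ?_
      have hi' := Finset.mem_range.1 hi
      have b1 : Measurable[ℱ t] (u i) := (hu i).mono (ℱ.mono hi'.le) le_rfl
      have b2 : Measurable[ℱ t] (w (i + 1)) := (hw.measurable i).mono (ℱ.mono hi') le_rfl
      exact b1.mul ((measurable_clip _).comp b2)
    have a3 : Measurable[ℱ t] fun ω => ((hits D t ω : ℕ) : ℝ) :=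
      (measurable_from_top (f := fun k : ℕ => (k : ℝ))).comp a1
    exact (Real.measurable_exp.comp ((a2.const_mul l).sub (a3.const_mul _))).ennreal_ofReal
  refine ⟨hXm, fun t F hF => ?_⟩
  set X : Ω → ℝ≥0∞ := fun ω => ENNReal.ofReal (Real.exp
      (l * ∑ i ∈ Finset.range t, u i ω * clip l⁻¹ (w (i + 1) ω) -
        2 * l ^ 2 * s * hits D t ω)) with hX
  have hXm' : Measurable[ℱ t] X := hXm t
  let g : ℝ → ℝ≥0∞ := fun v => ENNReal.ofReal (Real.exp (-(2 * l ^ 2 * s * v)))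
  let H : ℝ≥0∞ × ℝ × ℝ → ℝ → ℝ≥0∞ := fun z x =>
    z.1 * g z.2.2 * ENNReal.ofReal (Real.exp (l * (z.2.1 * clip l⁻¹ x)))
  have hclipm := measurable_clip l⁻¹
  have hH : Measurable (Function.uncurry H) := by
    simp only [Function.uncurry_def, H, g]; fun_prop
  set Z : Ω → ℝ≥0∞ × ℝ × ℝ := fun ω => (F.indicator X ω, u t ω, (D t).indicator 1 ω) with hZdef
  have hone : Measurable[ℱ t] (1 : Ω → ℝ) := measurable_const (a := (1 : ℝ))
  have hZ : Measurable[ℱ t] Z :=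
    (hXm'.indicator hF).prodMk ((hu t).prodMk (hone.indicator (hD t)))
  have hFm : MeasurableSet F := ℱ.le _ _ hF
  rw [← lintegral_indicator hFm, ← lintegral_indicator hFm]
  have hsucc : ∀ ω, F.indicator (fun ω => ENNReal.ofReal (Real.exp
      (l * ∑ i ∈ Finset.range (t + 1), u i ω * clip l⁻¹ (w (i + 1) ω) -
        2 * l ^ 2 * s * hits D (t + 1) ω))) ω = H (Z ω) (w (t + 1) ω) := by
    intro ω
    by_cases hω : ω ∈ F
    · have hh : (hits D (t + 1) ω : ℝ) = hits D t ω + (D t).indicator 1 ω := by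
        by_cases hd : ω ∈ D t
        · simp [hits_succ_of_mem hd, hd]
        · simp [hits_succ_of_notMem hd, hd]
      simp only [Set.indicator_of_mem hω, H, hZdef, g, hX]
      rw [← ENNReal.ofReal_mul (Real.exp_pos _).le, ← Real.exp_add,
        ← ENNReal.ofReal_mul (Real.exp_pos _).le, ← Real.exp_add, Finset.sum_range_succ, hh]
      ring_nf
    · simp [Set.indicator_of_notMem hω, H, hZdef]
  calc ∫⁻ ω, F.indicator (fun ω => ENNReal.ofReal (Real.exp
      (l * ∑ i ∈ Finset.range (t + 1), u i ω * clip l⁻¹ (w (i + 1) ω) -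
        2 * l ^ 2 * s * hits D (t + 1) ω))) ω ∂P = ∫⁻ ω, H (Z ω) (w (t + 1) ω) ∂P :=
        lintegral_congr hsucc
    _ = ∫⁻ ω, ∫⁻ x, H (Z ω) x ∂μ ∂P := hw.lintegral_comp t hZ hH
    _ ≤ ∫⁻ ω, F.indicator X ω ∂P := by
        refine lintegral_mono fun ω => ?_
        simp only [H, hZdef]
        rw [lintegral_const_mul _ (by fun_prop)]
        have hle : g ((D t).indicator 1 ω) *
            ∫⁻ x, ENNReal.ofReal (Real.exp (l * (u t ω * clip l⁻¹ x))) ∂μ ≤ 1 := by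
          have hut := huD t ω
          by_cases hd : ω ∈ D t
          · rw [Set.indicator_of_mem hd] at hut ⊢
            refine (mul_le_mul_right (lintegral_exp_mul_clip_le h0 h1 h2 hl hut) _).trans ?_
            simp only [g]
            rw [← ENNReal.ofReal_mul (Real.exp_pos _).le, ← Real.exp_add]
            simp [hs]
          · rw [Set.indicator_of_notMem hd] at hut ⊢
            have : u t ω = 0 := abs_eq_zero.1 (le_antisymm hut (abs_nonneg _))
            simp [this, g]
        calc _ = F.indicator X ω * (g ((D t).indicator 1 ω) *
            ∫⁻ x, ENNReal.ofReal (Real.exp (l * (u t ω * clip l⁻¹ x))) ∂μ) := mul_assoc _ _ _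
          _ ≤ F.indicator X ω * 1 := by gcongr
          _ = _ := mul_one _

/-- If `∑ P(|w_1| > r_k)` is finite, then `|w_{i+1}|` exceeds the threshold `r` at the number of
occurrences of `D` so far only for finitely many `i` with `D i`. -/
theorem IsAdaptedNoise.ae_eventually_abs_le [IsProbabilityMeasure P]
    {ℱ : Filtration ℕ mΩ} {w : ℕ → Ω → ℝ} {μ : Measure ℝ}
    (hw : IsAdaptedNoise P ℱ w μ) {r : ℕ → ℝ} (hr : ∑' k, μ {x | r (k + 1) < |x|} ≠ ∞)
    {D : ℕ → Set Ω} (hD : ∀ t, MeasurableSet[ℱ t] (D t)) :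
    ∀ᵐ ω ∂P, ∀ᶠ i in atTop, ω ∈ D i → |w (i + 1) ω| ≤ r (hits D (i + 1) ω) := by
  set q : ℕ → ℝ≥0∞ := fun k => μ {x | r k < |x|} with hq
  -- Change of clock: along a path, the occurrences of `D` carry the thresholds `1, 2, 3, …` once
  -- each, so the random series is a partial sum of the deterministic one.
  have hpartial : ∀ ω t, ∑ i ∈ Finset.range t, (D i).indicator (fun ω => q (hits D (i + 1) ω)) ω
      = ∑ k ∈ Finset.range (hits D t ω), q (k + 1) := by
    intro ω t
    induction t with
    | zero => simp [hits_zero]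
    | succ t ih =>
      rw [Finset.sum_range_succ, ih]
      by_cases hd : ω ∈ D t
      · rw [Set.indicator_of_mem hd, hits_succ_of_mem hd, Finset.sum_range_succ]
      · rw [Set.indicator_of_notMem hd, hits_succ_of_notMem hd, add_zero]
  have hsum : ∀ ω, ∑' i, (D i).indicator (fun ω => q (hits D (i + 1) ω)) ω ≤ ∑' k, q (k + 1) := by
    intro ω
    refine ENNReal.tsum_le_of_sum_range_le fun t => ?_
    rw [hpartial]
    exact ENNReal.sum_le_tsum _
  -- The count through step `i` includes `D i` itself, and is still known before `w (i + 1)` is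
  -- drawn.
  have hhits : ∀ i, Measurable[ℱ i] (hits D (i + 1)) := fun i =>
    measurable_hits _ fun j hj => ℱ.mono (Nat.lt_succ_iff.1 hj) _ (hD j)
  have hPi : ∀ i, P {ω | ω ∈ D i ∧ r (hits D (i + 1) ω) < |w (i + 1) ω|} =
      ∫⁻ ω, (D i).indicator (fun ω => q (hits D (i + 1) ω)) ω ∂P := by
    intro i
    let H : ℝ≥0∞ × ℝ → ℝ → ℝ≥0∞ := fun z x => z.1 * {p : ℝ × ℝ | p.1 < |p.2|}.indicator 1 (z.2, x)
    have hS : MeasurableSet {p : ℝ × ℝ | p.1 < |p.2|} :=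
      measurableSet_lt measurable_fst (by fun_prop)
    have hH : Measurable (Function.uncurry H) := by
      have h1 : Measurable ({p : ℝ × ℝ | p.1 < |p.2|}.indicator (1 : ℝ × ℝ → ℝ≥0∞)) :=
        measurable_one.indicator hS
      simp only [Function.uncurry_def, H]
      fun_prop
    have hrm : Measurable[ℱ i] fun ω => r (hits D (i + 1) ω) :=
      (measurable_from_top (f := r)).comp (hhits i)
    have hone : Measurable[ℱ i] (1 : Ω → ℝ≥0∞) := measurable_const (a := (1 : ℝ≥0∞))
    have hZ : Measurable[ℱ i] fun ω => (((D i).indicator 1 ω : ℝ≥0∞), r (hits D (i + 1) ω)) :=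
      (hone.indicator (hD i)).prodMk hrm
    have hDm := ℱ.le _ _ (hD i)
    have hm : MeasurableSet {ω | ω ∈ D i ∧ r (hits D (i + 1) ω) < |w (i + 1) ω|} :=
      hDm.inter (measurableSet_lt (hrm.mono (ℱ.le i) le_rfl)
        (((hw.measurable i).mono (ℱ.le _) le_rfl).abs))
    rw [← lintegral_indicator_one hm]
    calc _ = ∫⁻ ω, H ((D i).indicator 1 ω, r (hits D (i + 1) ω)) (w (i + 1) ω) ∂P := by
          refine lintegral_congr fun ω => ?_
          by_cases hd : ω ∈ D i <;> simp [H, hd, Set.indicator]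
      _ = _ := hw.lintegral_comp i hZ hH
      _ = _ := by
          refine lintegral_congr fun ω => ?_
          simp only [H]
          by_cases hd : ω ∈ D i
          · simp only [Set.indicator_of_mem hd, Pi.one_apply, one_mul, hq]
            rw [← lintegral_indicator_one (measurableSet_lt measurable_const (by fun_prop))]
            rfl
          · simp [hd]
  have hfin : ∑' i, P {ω | ω ∈ D i ∧ r (hits D (i + 1) ω) < |w (i + 1) ω|} ≠ ∞ := by
    simp only [hPi]
    rw [← lintegral_tsum fun i => ?_]
    · refine ne_top_of_le_ne_top hr ?_
      calc _ ≤ ∫⁻ _, ∑' k, q (k + 1) ∂P := lintegral_mono hsum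
        _ = _ := by simp [hq]
    · have : Measurable[ℱ i] ((D i).indicator fun ω => q (hits D (i + 1) ω)) :=
        ((measurable_from_top (f := q)).comp (hhits i)).indicator (hD i)
      exact (this.mono (ℱ.le i) le_rfl).aemeasurable
  filter_upwards [ae_eventually_notMem hfin] with ω hω
  filter_upwards [hω] with i hi hd
  by_contra! hlt
  exact hi ⟨hd, hlt⟩

end Growth

/-! ### The `√(k log k)` bound on the clock of occurrences -/

section GrowthBound

/-- Choose `1 / β < a < 1 / 2`. Markov's inequality bounds the `k`th tail by a multiple of `k ^ (-a
β)`, summable as `a β > 1`; `a < 1 / 2` keeps the thresholds below the clipping level `√(k / log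
k)`. -/
theorem exists_rpow_threshold {μ : Measure ℝ} [IsProbabilityMeasure μ] {β : ℝ} (hβ : 2 < β)
    (h : Integrable (fun x => |x| ^ β) μ) :
    ∃ a : ℝ, 0 < a ∧ a < 1 / 2 ∧ ∑' k : ℕ, μ {x | ((k + 1 : ℕ) : ℝ) ^ a < |x|} ≠ ∞ := by
  obtain ⟨a, ha1, ha2⟩ : ∃ a : ℝ, 1 / β < a ∧ a < 1 / 2 :=
    exists_between (one_div_lt_one_div_of_lt two_pos hβ)
  have hβ0 : 0 < β := by linarith
  have ha0 : 0 < a := (by positivity : 0 < 1 / β).trans ha1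
  refine ⟨a, ha0, ha2, ?_⟩
  have haβ : 1 < a * β := by rwa [div_lt_iff₀ hβ0] at ha1
  have hsum : Summable fun k : ℕ => (∫ x, |x| ^ β ∂μ) * (1 / ((k + 1 : ℕ) : ℝ) ^ (a * β)) :=
    ((summable_nat_add_iff 1).2 (Real.summable_one_div_nat_rpow.2 haβ)).mul_left _
  refine ne_top_of_le_ne_top hsum.tsum_ofReal_ne_top (ENNReal.tsum_le_tsum fun k => ?_)
  have hk : 0 < ((k + 1 : ℕ) : ℝ) := by positivity
  have hm := mul_meas_ge_le_integral_of_nonneg (μ := μ)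
    (Eventually.of_forall fun x => Real.rpow_nonneg (abs_nonneg x) β) h
    (((k + 1 : ℕ) : ℝ) ^ (a * β))
  have hle : μ.real {x | ((k + 1 : ℕ) : ℝ) ^ a < |x|} ≤
      μ.real {x | ((k + 1 : ℕ) : ℝ) ^ (a * β) ≤ |x| ^ β} := by
    refine measureReal_mono fun x hx => ?_
    rw [Set.mem_ofPred_eq] at hx ⊢
    rw [Real.rpow_mul hk.le]
    exact Real.rpow_le_rpow (by positivity) hx.le hβ0.le
  rw [← ofReal_measureReal]
  refine ENNReal.ofReal_le_ofReal (hle.trans ?_)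
  rw [mul_one_div, le_div_iff₀ (by positivity), mul_comm]
  exact hm

theorem eventually_rpow_le_sqrt_div_log {a : ℝ} (ha : a < 1 / 2) :
    ∀ᶠ k : ℕ in atTop, (k : ℝ) ^ a ≤ Real.sqrt (k / Real.log k) := by
  have h1 : (fun x : ℝ => Real.log x) =o[atTop] fun x => x ^ (1 - 2 * a) :=
    isLittleO_log_rpow_atTop (by linarith)
  have h2 : ∀ᶠ x : ℝ in atTop, x ^ a ≤ Real.sqrt (x / Real.log x) := by
    filter_upwards [h1.bound one_pos, eventually_gt_atTop 1] with x hx hx1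
    have hx0 : 0 < x := by linarith
    have hlog : 0 < Real.log x := Real.log_pos hx1
    rw [one_mul, Real.norm_of_nonneg hlog.le, Real.norm_of_nonneg (by positivity)] at hx
    refine Real.le_sqrt_of_sq_le ?_
    rw [le_div_iff₀ hlog, ← Real.rpow_natCast, ← Real.rpow_mul hx0.le]
    calc x ^ (a * (2 : ℕ)) * Real.log x ≤ x ^ (a * (2 : ℕ)) * x ^ (1 - 2 * a) := by gcongr
      _ = x := by rw [← Real.rpow_add hx0]; norm_num; ring_nf; simp
  exact tendsto_natCast_atTop_atTop.eventually h2

variable {Ω : Type*} {mΩ : MeasurableSpace Ω} {P : Measure Ω}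

/-- A sum of the noise with predictable weights in `[-1, 1]` is of order at most
`√(k log k)`, where `k` counts the steps at which the weight may differ from zero. -/
theorem IsAdaptedNoise.ae_sum_le [IsProbabilityMeasure P]
    {ℱ : Filtration ℕ mΩ} {w : ℕ → Ω → ℝ} {μ : Measure ℝ} [IsProbabilityMeasure μ]
    (hw : IsAdaptedNoise P ℱ w μ) (h0 : ∫ x, x ∂μ = 0)
    {β : ℝ} (hβ : 2 < β) (hint : Integrable (fun x => |x| ^ β) μ)
    {u : ℕ → Ω → ℝ} (hu : ∀ t, Measurable[ℱ t] (u t)) {D : ℕ → Set Ω}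
    (hD : ∀ t, MeasurableSet[ℱ t] (D t)) (huD : ∀ t ω, |u t ω| ≤ (D t).indicator 1 ω) :
    ∃ c : ℝ, 0 ≤ c ∧ ∀ᵐ ω ∂P, ∃ k₀ : ℕ, ∀ t, k₀ ≤ hits D t ω →
      ∑ i ∈ Finset.range t, u i ω * w (i + 1) ω ≤
        c * Real.sqrt (hits D t ω * Real.log (hits D t ω)) := by
  have hβ0 : (0 : ℝ) < β := by linarith
  have hLp : MemLp (fun x : ℝ => x) (ENNReal.ofReal β) μ := by
    rw [← integrable_norm_rpow_iff (by fun_prop) (by simpa using hβ0) ENNReal.ofReal_ne_top,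
      ENNReal.toReal_ofReal hβ0.le]
    exact hint
  have h1 : Integrable (fun x : ℝ => x) μ :=
    hLp.integrable (ENNReal.one_le_ofReal.2 (by linarith))
  have h2 : Integrable (fun x : ℝ => x ^ 2) μ :=
    (hLp.mono_exponent (p := 2) (ENNReal.ofNat_le_ofReal.2 (by simpa using hβ.le))).integrable_sq
  set s := ∫ x, x ^ 2 ∂μ with hs
  have hs0 : 0 ≤ s := integral_nonneg fun x => sq_nonneg x
  refine ⟨2 * s + 2, by positivity, ?_⟩
  obtain ⟨a, ha0, ha, hsum⟩ := exists_rpow_threshold hβ hint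
  -- This choice balances `l S` against the compensator: `l² k = log k`.
  let l : ℕ → ℝ := fun k => Real.sqrt (Real.log k / k)
  -- For the `k`th process only the first `k` occurrences of `D` are retained; at a time when the
  -- count equals `k` this removes nothing.
  let E : ℕ → ℕ → Set Ω := fun k i => {ω | hits D (i + 1) ω ≤ k}
  have hE : ∀ k i, MeasurableSet[ℱ i] (E k i) := fun k i =>
    (measurable_hits (ℱ := ℱ) (s := i) (i + 1) fun j hj => ℱ.mono (Nat.lt_succ_iff.1 hj) _ (hD j))
      (measurableSet_Iic (a := k))
  let X : ℕ → ℕ → Ω → ℝ≥0∞ := fun k t ω => ENNReal.ofReal (Real.exp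
    (l k * ∑ i ∈ Finset.range t, (E k i).indicator (u i) ω * clip (l k)⁻¹ (w (i + 1) ω) -
        2 * l k ^ 2 * s * hits (fun i => D i ∩ E k i) t ω))
  have hX : ∀ k, 2 ≤ k → IsNonincreasingOnAverage P ℱ (X k) := by
    intro k hk
    have hk2 : (2 : ℝ) ≤ k := by exact_mod_cast hk
    have hl : 0 < l k :=
      Real.sqrt_pos.2 (div_pos (Real.log_pos (by linarith)) (by linarith))
    refine hw.isNonincreasingOnAverage_exp h0 h1 h2 (fun t => (hu t).indicator (hE k t))
      (fun t => (hD t).inter (hE k t)) (fun t ω => ?_) hl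
    have := huD t ω
    by_cases hd : ω ∈ D t <;> by_cases he : ω ∈ E k t <;> simp_all
  -- The level `k²` makes the maximal bounds `1 / k²` summable and costs only `2 log k` in the
  -- exponent. The shift by `2` ensures `log k > 0`.
  have hXsum : ∑' k : ℕ, P {ω | ∃ t, (((k + 2 : ℕ) ^ 2 : ℕ) : ℝ≥0∞) ≤ X (k + 2) t ω} ≠ ∞ := by
    have hsum2 : Summable fun k : ℕ => 1 / (((k + 2 : ℕ) : ℝ) ^ 2) :=
      (summable_nat_add_iff 2).2 (Real.summable_one_div_nat_pow.2 one_lt_two)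
    refine ne_top_of_le_ne_top hsum2.tsum_ofReal_ne_top (ENNReal.tsum_le_tsum fun k => ?_)
    have hm := (hX (k + 2) (by lia)).mul_measure_exists_le (((k + 2 : ℕ) ^ 2 : ℕ) : ℝ≥0∞)
    have hX0 : ∫⁻ ω, X (k + 2) 0 ω ∂P = 1 := by simp [X, hits_zero]
    rw [hX0, mul_comm, ← ENNReal.le_div_iff_mul_le (Or.inl (by simp)) (Or.inl (by simp))] at hm
    refine hm.trans (le_of_eq ?_)
    rw [ENNReal.ofReal_div_of_pos (by positivity), ENNReal.ofReal_one]
    congr 1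
    rw [← Nat.cast_pow, ENNReal.ofReal_natCast]
  have hlarge := hw.ae_eventually_abs_le (r := fun k : ℕ => (k : ℝ) ^ a) hsum hD
  filter_upwards [ae_eventually_notMem hXsum, hlarge] with ω hω1 hω2
  obtain ⟨k₁, hk₁⟩ := eventually_atTop.1 hω1
  obtain ⟨i₀, hi₀⟩ := eventually_atTop.1 hω2
  obtain ⟨k₂, hk₂⟩ := eventually_atTop.1 (eventually_rpow_le_sqrt_div_log ha)
  obtain ⟨R, hR⟩ : ∃ R : ℝ, ∀ i < i₀, |w (i + 1) ω| ≤ R := by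
    refine ⟨∑ i ∈ Finset.range i₀, |w (i + 1) ω|, fun i hi => ?_⟩
    exact Finset.single_le_sum (f := fun i => |w (i + 1) ω|) (fun j _ => abs_nonneg _)
      (Finset.mem_range.2 hi)
  obtain ⟨k₃, hk₃⟩ := eventually_atTop.1
    (((tendsto_rpow_atTop ha0).comp tendsto_natCast_atTop_atTop).eventually_ge_atTop R)
  refine ⟨k₁ + k₂ + k₃ + 2, fun t ht => ?_⟩
  set k := hits D t ω with hk
  have hk2 : (2 : ℝ) ≤ k := by exact_mod_cast (by lia : 2 ≤ k)
  have hlog : 0 < Real.log k := Real.log_pos (by linarith)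
  have hl : 0 < l k := Real.sqrt_pos.2 (div_pos hlog (by linarith))
  have hlinv : (l k)⁻¹ = Real.sqrt (k / Real.log k) := by
    simp only [l]; rw [← Real.sqrt_inv, inv_div]
  have hmem : ∀ i < t, ω ∈ E k i := fun i hi => hits_mono D ω hi
  -- Clipping is inactive: late noises obey the `k ^ a` threshold, and the finitely many early ones
  -- are below `R`, which `k ^ a` eventually exceeds.
  have hclip : ∀ i < t, ω ∈ D i → |w (i + 1) ω| ≤ (l k)⁻¹ := by
    intro i hi hd
    rw [hlinv]
    refine le_trans ?_ (hk₂ k (by lia))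
    rcases lt_or_ge i i₀ with h | h
    · exact (hR i h).trans (hk₃ k (by lia))
    · refine (hi₀ i h hd).trans (Real.rpow_le_rpow (by positivity) ?_ ha0.le)
      exact_mod_cast hmem i hi
  have hsumeq : ∑ i ∈ Finset.range t, (E k i).indicator (u i) ω * clip (l k)⁻¹ (w (i + 1) ω)
      = ∑ i ∈ Finset.range t, u i ω * w (i + 1) ω := by
    refine Finset.sum_congr rfl fun i hi => ?_
    have hi' := Finset.mem_range.1 hi
    rw [Set.indicator_of_mem (hmem i hi')]
    by_cases hd : ω ∈ D i
    · rw [clip_of_abs_le (hclip i hi' hd)]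
    · have := huD i ω
      rw [Set.indicator_of_notMem hd] at this
      rw [abs_eq_zero.1 (le_antisymm this (abs_nonneg _)), zero_mul, zero_mul]
  have hhits : hits (fun i => D i ∩ E k i) t ω ≤ k :=
    hits_le_hits fun i _ hi => hi.1
  have hnot := hk₁ (k - 2) (by lia)
  have hXlt : X k t ω < ((k ^ 2 : ℕ) : ℝ≥0∞) := by
    by_contra! hle
    refine hnot ⟨t, ?_⟩
    rwa [Nat.sub_add_cancel (by lia : 2 ≤ k)]
  simp only [X, hsumeq] at hXlt
  have hk0 : 0 < k := by lia
  rw [ENNReal.ofReal_lt_natCast (by positivity)] at hXlt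
  have hlt := (Real.lt_log_iff_exp_lt (by positivity)).2 hXlt
  push_cast at hlt
  rw [Real.log_pow] at hlt
  have hl2 : l k ^ 2 = Real.log k / k := Real.sq_sqrt (by positivity)
  have hb : 2 * l k ^ 2 * s * hits (fun i => D i ∩ E k i) t ω ≤ 2 * s * Real.log k := by
    calc 2 * l k ^ 2 * s * hits (fun i => D i ∩ E k i) t ω ≤ 2 * l k ^ 2 * s * k := by gcongr
      _ = 2 * s * Real.log k := by rw [hl2]; field_simp
  have hfin : l k * ∑ i ∈ Finset.range t, u i ω * w (i + 1) ω ≤ (2 * s + 2) * Real.log k := by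
    push_cast at hlt; linarith
  have hroot : Real.log k = l k * Real.sqrt (k * Real.log k) := by
    simp only [l]
    rw [← Real.sqrt_mul (by positivity)]
    rw [show Real.log k / k * (k * Real.log k) = Real.log k ^ 2 by field_simp,
      Real.sqrt_sq hlog.le]
  refine le_of_mul_le_mul_left ?_ hl
  calc _ ≤ (2 * s + 2) * Real.log k := hfin
    _ = l k * ((2 * s + 2) * Real.sqrt (k * Real.log k)) := by
      nth_rewrite 1 [hroot]; ring

/-- Rescale the weights by `K⁻¹` and apply the one-sided bound to them and to their negatives. -/
theorem IsAdaptedNoise.ae_abs_sum_le [IsProbabilityMeasure P]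
    {ℱ : Filtration ℕ mΩ} {w : ℕ → Ω → ℝ} {μ : Measure ℝ} [IsProbabilityMeasure μ]
    (hw : IsAdaptedNoise P ℱ w μ) (h0 : ∫ x, x ∂μ = 0)
    {β : ℝ} (hβ : 2 < β) (hint : Integrable (fun x => |x| ^ β) μ)
    {u : ℕ → Ω → ℝ} (hu : ∀ t, Measurable[ℱ t] (u t)) {D : ℕ → Set Ω}
    (hD : ∀ t, MeasurableSet[ℱ t] (D t)) {K : ℝ} (hK : 0 < K)
    (huD : ∀ t ω, |u t ω| ≤ (D t).indicator (fun _ => K) ω) :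
    ∃ c : ℝ, 0 ≤ c ∧ ∀ᵐ ω ∂P, ∃ k₀ : ℕ, ∀ t, k₀ ≤ hits D t ω →
      |∑ i ∈ Finset.range t, u i ω * w (i + 1) ω| ≤
        c * Real.sqrt (hits D t ω * Real.log (hits D t ω)) := by
  have hbound : ∀ t ω, |K⁻¹ * u t ω| ≤ (D t).indicator 1 ω := by
    intro t ω
    have := huD t ω
    rw [abs_mul, abs_of_pos (inv_pos.2 hK)]
    by_cases hd : ω ∈ D t
    · rw [Set.indicator_of_mem hd] at this ⊢
      rw [Pi.one_apply, inv_mul_le_iff₀ hK, mul_one]; exact this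
    · rw [Set.indicator_of_notMem hd] at this ⊢
      rw [le_antisymm this (abs_nonneg _), mul_zero]
  obtain ⟨c₁, hc₁, h₁⟩ := hw.ae_sum_le h0 hβ hint (u := fun t ω => K⁻¹ * u t ω)
    (fun t => (hu t).const_mul _) hD hbound
  obtain ⟨c₂, hc₂, h₂⟩ := hw.ae_sum_le h0 hβ hint (u := fun t ω => -(K⁻¹ * u t ω))
    (fun t => ((hu t).const_mul _).neg) hD fun t ω => by rw [abs_neg]; exact hbound t ω
  refine ⟨K * (c₁ + c₂), by positivity, ?_⟩
  filter_upwards [h₁, h₂] with ω ⟨k₁, hk₁⟩ ⟨k₂, hk₂⟩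
  refine ⟨k₁ + k₂, fun t ht => ?_⟩
  have e₁ := hk₁ t (by lia)
  have e₂ := hk₂ t (by lia)
  set r := Real.sqrt (hits D t ω * Real.log (hits D t ω)) with hr
  have hr0 : 0 ≤ r := Real.sqrt_nonneg _
  have hS : ∑ i ∈ Finset.range t, K⁻¹ * u i ω * w (i + 1) ω
      = K⁻¹ * ∑ i ∈ Finset.range t, u i ω * w (i + 1) ω := by
    rw [Finset.mul_sum]; exact Finset.sum_congr rfl fun i _ => mul_assoc _ _ _
  simp only [neg_mul, Finset.sum_neg_distrib] at e₂
  rw [hS] at e₁ e₂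
  rw [inv_mul_le_iff₀ hK] at e₁
  rw [← mul_neg, inv_mul_le_iff₀ hK] at e₂
  have p₁ : 0 ≤ K * (c₁ * r) := by positivity
  have p₂ : 0 ≤ K * (c₂ * r) := by positivity
  rw [abs_le]
  constructor <;> linarith

end GrowthBound

/-! ### The conditional law of the next window -/

section Recurrence

/-- The cube `[-L, L]^j`. -/
def cube (L : ℝ) (j : ℕ) : Set (Fin j → ℝ) := Set.univ.pi fun _ => Set.Icc (-L) L

theorem measurableSet_cube (L : ℝ) (j : ℕ) : MeasurableSet (cube L j) :=
  MeasurableSet.univ_pi fun _ => measurableSet_Icc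

theorem cons_mem_cube {L : ℝ} {j : ℕ} {x : ℝ} {z : Fin j → ℝ} :
    (Fin.cons x z : Fin (j + 1) → ℝ) ∈ cube L (j + 1) ↔ x ∈ Set.Icc (-L) L ∧ z ∈ cube L j := by
  simp only [cube, Set.mem_univ_pi, Fin.forall_fin_succ, Fin.cons_zero, Fin.cons_succ]

theorem measurable_finCons (j : ℕ) :
    Measurable fun p : ℝ × (Fin j → ℝ) => (Fin.cons p.1 p.2 : Fin (j + 1) → ℝ) := by
  refine measurable_pi_iff.2 fun k => ?_
  refine Fin.cases ?_ (fun k => ?_) k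
  · simpa using measurable_fst
  · simp only [Fin.cons_succ]; fun_prop

theorem lintegral_cube_zero (L : ℝ) (g : (Fin 0 → ℝ) → ℝ≥0∞) (z : Fin 0 → ℝ) :
    ∫⁻ x in cube L 0, g x = g z := by
  have h : cube L 0 = Set.univ := by ext; simp [cube]
  rw [h, Measure.restrict_univ, volume_pi, Measure.pi_of_empty _ z, lintegral_dirac]

theorem lintegral_cube_succ (L : ℝ) (j : ℕ) {g : (Fin (j + 1) → ℝ) → ℝ≥0∞} (hg : Measurable g) :
    ∫⁻ x in cube L (j + 1), g x =
      ∫⁻ z in cube L j, ∫⁻ x in Set.Icc (-L) L, g (Fin.cons x z) := by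
  have hc := measurable_finCons j
  have hgi : Measurable ((cube L (j + 1)).indicator g) := hg.indicator (measurableSet_cube L _)
  rw [← lintegral_indicator (measurableSet_cube L _),
    ← (volume_preserving_piFinSuccAbove (fun _ : Fin (j + 1) => ℝ) 0).symm.lintegral_comp hgi,
    Measure.volume_eq_prod, lintegral_prod_symm _ (by fun_prop),
    ← lintegral_indicator (measurableSet_cube L _)]
  refine lintegral_congr fun z => ?_
  have he : ∀ x : ℝ, (MeasurableEquiv.piFinSuccAbove (fun _ : Fin (j + 1) => ℝ) 0).symm (x, z)
      = Fin.cons x z := fun x => by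
    simp [MeasurableEquiv.piFinSuccAbove, Fin.insertNthEquiv]
  by_cases hz : z ∈ cube L j
  · rw [Set.indicator_of_mem hz, ← lintegral_indicator measurableSet_Icc]
    refine lintegral_congr fun x => ?_
    rw [he]
    by_cases hx : x ∈ Set.Icc (-L) L
    · rw [Set.indicator_of_mem hx, Set.indicator_of_mem (cons_mem_cube.2 ⟨hx, hz⟩)]
    · rw [Set.indicator_of_notMem hx, Set.indicator_of_notMem fun h => hx (cons_mem_cube.1 h).1]
  · rw [Set.indicator_of_notMem hz]
    simp only [he]
    simp [Set.indicator_of_notMem fun h => hz (cons_mem_cube.1 h).2]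

/-- `μ` has a component with a density bounded away from zero on every bounded interval. -/
def HasLocallyPositiveDensity (μ : Measure ℝ) : Prop :=
  ∀ L : ℝ, 0 < L → ∃ c : ℝ, 0 < c ∧ ENNReal.ofReal c • volume.restrict (Set.Icc (-L) L) ≤ μ

theorem hasLocallyPositiveDensity_withDensity {ρ : ℝ → ℝ} (hm : Measurable ρ)
    (h : ∀ a b : ℝ, a < b → ∃ c : ℝ, 0 < c ∧ ∀ x ∈ Set.Icc a b, c ≤ ρ x) :
    HasLocallyPositiveDensity (volume.withDensity fun x => ENNReal.ofReal (ρ x)) := by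
  intro L hL
  obtain ⟨c, hc, hcρ⟩ := h (-L) L (by linarith)
  refine ⟨c, hc, Measure.le_iff.2 fun s hs => ?_⟩
  rw [withDensity_apply _ hs, Measure.smul_apply, smul_eq_mul,
    Measure.restrict_apply hs, ← setLIntegral_const]
  calc ∫⁻ _ in s ∩ Set.Icc (-L) L, ENNReal.ofReal c
      ≤ ∫⁻ x in s ∩ Set.Icc (-L) L, ENNReal.ofReal (ρ x) :=
        setLIntegral_mono hm.ennreal_ofReal fun x hx => ENNReal.ofReal_le_ofReal (hcρ x hx.2)
    _ ≤ _ := lintegral_mono_set Set.inter_subset_left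

theorem hasLocallyPositiveDensity_gaussianReal :
    HasLocallyPositiveDensity (gaussianReal 0 1) := by
  rw [gaussianReal_of_var_ne_zero 0 one_ne_zero]
  refine hasLocallyPositiveDensity_withDensity (measurable_gaussianPDFReal 0 1) fun a b hab => ?_
  have hcont : Continuous (gaussianPDFReal 0 1) := by unfold gaussianPDFReal; fun_prop
  obtain ⟨x, -, hx⟩ := isCompact_Icc.exists_isMinOn (Set.nonempty_Icc.2 hab.le) hcont.continuousOn
  exact ⟨_, gaussianPDFReal_pos 0 1 x one_ne_zero, fun z hz => hx hz⟩

/-- The interval is widened by `V` so that it still contains `[-L, L]` after a shift of size at most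
`V`. -/
theorem lintegral_translate_ge {μ : Measure ℝ} {L V c : ℝ}
    (h : ENNReal.ofReal c • volume.restrict (Set.Icc (-(L + V)) (L + V)) ≤ μ) {v : ℝ}
    (hv : |v| ≤ V) {g : ℝ → ℝ≥0∞} :
    ENNReal.ofReal c * ∫⁻ x in Set.Icc (-L) L, g x ≤ ∫⁻ x, g (v + x) ∂μ := by
  obtain ⟨hv1, hv2⟩ := abs_le.1 hv
  calc ENNReal.ofReal c * ∫⁻ x in Set.Icc (-L) L, g x
      = ENNReal.ofReal c * ∫⁻ x, (Set.Icc (-L) L).indicator g (v + x) := by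
        rw [lintegral_add_left_eq_self (μ := volume) ((Set.Icc (-L) L).indicator g) v,
          lintegral_indicator measurableSet_Icc]
    _ ≤ ENNReal.ofReal c * ∫⁻ x in Set.Icc (-(L + V)) (L + V), g (v + x) := by
        refine mul_le_mul_right ?_ _
        rw [← lintegral_indicator measurableSet_Icc]
        refine lintegral_mono fun x => ?_
        by_cases hx : v + x ∈ Set.Icc (-L) L
        · rw [Set.indicator_of_mem hx, Set.indicator_of_mem]
          exact ⟨by linarith [hx.1], by linarith [hx.2]⟩
        · rw [Set.indicator_of_notMem hx]; exact zero_le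
    _ ≤ ∫⁻ x, g (v + x) ∂μ := by
        rw [← smul_eq_mul, ← lintegral_smul_measure]
        exact lintegral_mono' h le_rfl

variable {Ω : Type*} {mΩ : MeasurableSpace Ω} {P : Measure Ω} {n m : ℕ}
  {φ : EuclideanSpace ℝ (Fin n) → EuclideanSpace ℝ (Fin m)}
  {θ : Ω → EuclideanSpace ℝ (Fin m)} {w : ℕ → Ω → ℝ} {y : ℤ → Ω → ℝ} {ℱ : Filtration ℕ mΩ}
  {μ : Measure ℝ}

theorem measurable_window {𝒢 : MeasurableSpace Ω} {s : ℤ} (h : ∀ r < s + n, Measurable[𝒢] (y r)) :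
    Measurable[𝒢] fun ω => window n (fun r => y r ω) s := by
  refine (WithLp.measurable_toLp 2 (Fin n → ℝ)).comp
    (@measurable_pi_lambda _ _ _ 𝒢 _ _ fun j => h _ ?_)
  lia

theorem IsModel.measurable_path (h : IsModel φ θ w y) (hw : IsAdaptedNoise P ℱ w μ)
    (hφ : Continuous φ) (hθ : Measurable[ℱ 0] θ) (hy : Measurable[ℱ 0] (y 0)) (t : ℕ) :
    ∀ s : ℤ, s ≤ t → Measurable[ℱ t] (y s) := by
  induction t with
  | zero =>
    intro s hs
    rcases hs.lt_or_eq with h' | h'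
    · have : y s = fun _ => 0 := funext (h.past s (by simpa using h'))
      rw [this]; exact measurable_const
    · rw [h']; exact hy
  | succ t ih =>
    intro s hs
    rcases hs.lt_or_eq with h' | h'
    · exact (ih s (by push_cast at h'; lia)).mono (ℱ.mono t.le_succ) le_rfl
    · have : y s = fun ω => inner ℝ (θ ω) (regressor φ (fun s => y s ω) t) + w (t + 1) ω := by
        rw [h']; exact funext fun ω => by rw [← h.step]; push_cast; rfl
      rw [this]
      have h1 : Measurable[ℱ (t + 1)] fun ω => regressor φ (fun s => y s ω) t :=
        hφ.measurable.comp (measurable_window fun r hr =>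
          (ih r (by lia)).mono (ℱ.mono t.le_succ) le_rfl)
      have h2 : Measurable[ℱ (t + 1)] θ := hθ.mono (ℱ.mono (Nat.zero_le _)) le_rfl
      exact (Measurable.inner h2 h1).add (hw.measurable t)

/-- `(y_{b+j}, …, y_{b+1})`. -/
def block (y : ℤ → Ω → ℝ) (b : ℤ) (j : ℕ) (ω : Ω) : Fin j → ℝ := fun k => y (b + j - (k : ℤ)) ω

theorem block_succ (b : ℤ) (j : ℕ) (ω : Ω) :
    block y b (j + 1) ω = Fin.cons (y (b + j + 1) ω) (block y b j ω) := by
  funext k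
  refine Fin.cases ?_ (fun k => ?_) k
  · simp [block, add_assoc]
  · simp only [block, Fin.cons_succ, Fin.val_succ]
    congr 1; push_cast; ring

theorem exists_norm_le_of_continuous (hφ : Continuous φ) (Q : ℝ) :
    ∃ K : ℝ, 0 ≤ K ∧ ∀ z : EuclideanSpace ℝ (Fin n), (∀ k, |z k| ≤ Q) → ‖φ z‖ ≤ K := by
  have hc : IsCompact ((WithLp.toLp 2 : (Fin n → ℝ) → EuclideanSpace ℝ (Fin n)) ''
      (Set.univ.pi fun _ => Set.Icc (-Q) Q)) :=
    (isCompact_univ_pi fun _ => isCompact_Icc).image (PiLp.continuous_toLp 2 _)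
  obtain ⟨K, hK⟩ := hc.exists_bound_of_continuousOn hφ.continuousOn
  refine ⟨max K 0, le_max_right _ _, fun z hz => (hK z ⟨z.ofLp, ?_, rfl⟩).trans (le_max_left _ _)⟩
  exact fun k _ => abs_le.1 (hz k)

theorem abs_coord_le_norm (z : EuclideanSpace ℝ (Fin n)) (k : Fin n) : |z k| ≤ ‖z‖ := by
  simpa using PiLp.norm_apply_le z k

/-- Given a bounded window and a bounded parameter, the law of the following block dominates a
multiple of Lebesgue measure on a cube. -/
theorem IsModel.lintegral_block_ge [IsProbabilityMeasure P] (h : IsModel φ θ w y)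
    (hw : IsAdaptedNoise P ℱ w μ) (hφ : Continuous φ) (hθ : Measurable[ℱ 0] θ)
    (hy : Measurable[ℱ 0] (y 0)) {L M R V c : ℝ}
    (hV : ∀ z : EuclideanSpace ℝ (Fin n), (∀ k, |z k| ≤ max L M) → R * ‖φ z‖ ≤ V)
    (hc : ENNReal.ofReal c • volume.restrict (Set.Icc (-(L + V)) (L + V)) ≤ μ)
    {i b : ℕ} (hb : b + 1 = i + n) {f : Ω → ℝ≥0∞} (hf : Measurable[ℱ b] f)
    (hfs : ∀ ω, f ω ≠ 0 → ‖window n (fun s => y s ω) i‖ ≤ M ∧ ‖θ ω‖ ≤ R) (j : ℕ) (hj : j ≤ n)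
    {g : (Fin j → ℝ) → ℝ≥0∞} (hg : Measurable g) :
    ENNReal.ofReal c ^ j * (∫⁻ ω, f ω ∂P) * ∫⁻ x in cube L j, g x ≤
      ∫⁻ ω, f ω * g (block y b j ω) ∂P := by
  have hpath := h.measurable_path hw hφ hθ hy
  have hblock : ∀ j : ℕ, Measurable[ℱ (b + j)] (block y b j) := fun j =>
    @measurable_pi_lambda _ _ _ (ℱ (b + j)) _ _ fun k => hpath _ _ (by push_cast; lia)
  -- One new output at a time, newest coordinate first: given the past, the new output is `v + w`,
  -- so its law contributes one factor `c` and one integration over `[-L, L]`.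
  induction j with
  | zero =>
    have : ∀ ω, g (block y b 0 ω) = ∫⁻ x in cube L 0, g x := fun ω =>
      (lintegral_cube_zero L g _).symm
    simp only [this, pow_zero, one_mul]
    rw [lintegral_mul_const _ (hf.mono (ℱ.le b) le_rfl)]
  | succ j ih =>
    have hcons := measurable_finCons j
    let G : (Fin j → ℝ) → ℝ≥0∞ := fun z => ∫⁻ x in Set.Icc (-L) L, g (Fin.cons x z)
    have hG : Measurable G :=
      Measurable.lintegral_prod_left' (f := fun p : ℝ × (Fin j → ℝ) => g (Fin.cons p.1 p.2))
        (hg.comp hcons)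
    have hGi : Measurable ((cube L j).indicator G) := hG.indicator (measurableSet_cube L j)
    have hIH := ih (by lia) hGi
    rw [lintegral_cube_succ L j hg, pow_succ']
    rw [setLIntegral_congr_fun (measurableSet_cube L j)
      (g := G) (fun z hz => Set.indicator_of_mem hz _)] at hIH
    let v : Ω → ℝ := fun ω => inner ℝ (θ ω) (regressor φ (fun s => y s ω) (b + j))
    have hv : Measurable[ℱ (b + j)] v := by
      have h1 : Measurable[ℱ (b + j)] fun ω => regressor φ (fun s => y s ω) (b + j) :=
        hφ.measurable.comp (measurable_window fun r hr => hpath _ r (by lia))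
      exact Measurable.inner (hθ.mono (ℱ.mono (Nat.zero_le _)) le_rfl) h1
    have hfm : Measurable[ℱ (b + j)] f := hf.mono (ℱ.mono (Nat.le_add_right _ _)) le_rfl
    -- The window feeding the next output mixes the `j` new values, which lie in the cube, with old
    -- values from the bounded window at `i`; no older value is involved since `j < n`.
    have hvb : ∀ ω, f ω ≠ 0 → block y b j ω ∈ cube L j → |v ω| ≤ V := by
      intro ω hω hbl
      obtain ⟨hM, hθR⟩ := hfs ω hω
      refine (abs_real_inner_le_norm _ _).trans ?_
      refine le_trans ?_ (hV (window n (fun s => y s ω) ((b + j : ℕ) - n + 1)) fun k => ?_)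
      · exact mul_le_mul_of_nonneg_right hθR (norm_nonneg _)
      · have hkn := k.2
        have hidx : window n (fun s => y s ω) ((b + j : ℕ) - n + 1) k
            = y ((b : ℤ) + j - (k : ℤ)) ω := by
          simp only [window]; congr 1; push_cast; ring
        rw [hidx]
        rcases lt_or_ge (k : ℕ) j with hkj | hkj
        · exact (abs_le.2 (hbl ⟨k, hkj⟩ trivial)).trans (le_max_left _ _)
        · have hk' : (k : ℕ) - j < n := by lia
          have := abs_coord_le_norm (window n (fun s => y s ω) i) ⟨k - j, hk'⟩
          have hidx2 : window n (fun s => y s ω) i ⟨k - j, hk'⟩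
              = y ((b : ℤ) + j - (k : ℤ)) ω := by
            simp only [window]; congr 1; lia
          rw [hidx2] at this
          exact (this.trans hM).trans (le_max_right _ _)
    let H : ℝ≥0∞ × ℝ × (Fin j → ℝ) → ℝ → ℝ≥0∞ := fun z x =>
      z.1 * (cube L j).indicator 1 z.2.2 * g (Fin.cons (z.2.1 + x) z.2.2)
    have hone : Measurable ((cube L j).indicator (1 : (Fin j → ℝ) → ℝ≥0∞)) :=
      measurable_one.indicator (measurableSet_cube L j)
    have hcomp : Measurable fun p : (ℝ≥0∞ × ℝ × (Fin j → ℝ)) × ℝ =>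
        g (Fin.cons (p.1.2.1 + p.2) p.1.2.2) :=
      hg.comp (hcons.comp (f := fun p : (ℝ≥0∞ × ℝ × (Fin j → ℝ)) × ℝ =>
        (p.1.2.1 + p.2, p.1.2.2)) (by fun_prop))
    have hH : Measurable (Function.uncurry H) := by
      simp only [Function.uncurry_def, H]
      exact (Measurable.mul (by fun_prop) (by fun_prop)).mul hcomp
    have hZ : Measurable[ℱ (b + j)] fun ω => (f ω, v ω, block y b j ω) :=
      hfm.prodMk (hv.prodMk (hblock j))
    have hy1 : ∀ ω, y (b + j + 1) ω = v ω + w (b + j + 1) ω := fun ω => by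
      have := h.step (b + j) ω
      push_cast at this
      exact this
    calc ENNReal.ofReal c * ENNReal.ofReal c ^ j * (∫⁻ ω, f ω ∂P) * ∫⁻ z in cube L j, G z
        = ENNReal.ofReal c * (ENNReal.ofReal c ^ j * (∫⁻ ω, f ω ∂P) * ∫⁻ z in cube L j, G z) := by
          ring
      _ ≤ ENNReal.ofReal c * ∫⁻ ω, f ω * (cube L j).indicator G (block y b j ω) ∂P := by gcongr
      _ = ∫⁻ ω, ENNReal.ofReal c * (f ω * (cube L j).indicator G (block y b j ω)) ∂P :=
          (lintegral_const_mul' _ _ ENNReal.ofReal_ne_top).symm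
      _ ≤ ∫⁻ ω, ∫⁻ x, H (f ω, v ω, block y b j ω) x ∂μ ∂P := by
          refine lintegral_mono fun ω => ?_
          simp only [H]
          rw [lintegral_const_mul _ (by
            exact hcomp.comp (measurable_const (a := (f ω, v ω, block y b j ω)) |>.prodMk
              measurable_id))]
          by_cases hω : f ω = 0
          · simp [hω]
          by_cases hbl : block y b j ω ∈ cube L j
          · simp only [Set.indicator_of_mem hbl, Pi.one_apply, mul_one]
            rw [mul_left_comm]
            gcongr
            exact lintegral_translate_ge hc (hvb ω hω hbl)
              (g := fun x => g (Fin.cons x (block y b j ω)))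
          · simp [Set.indicator_of_notMem hbl]
      _ = ∫⁻ ω, H (f ω, v ω, block y b j ω) (w (b + j + 1) ω) ∂P :=
          (hw.lintegral_comp (b + j) hZ hH).symm
      _ ≤ ∫⁻ ω, f ω * g (block y b (j + 1) ω) ∂P := by
          refine lintegral_mono fun ω => ?_
          simp only [H]
          rw [block_succ, hy1]
          gcongr
          exact mul_le_of_le_one_right zero_le (Set.indicator_apply_le fun _ => le_rfl)

end Recurrence

/-! ### Visits to a set of positive volume -/

section Excitation

variable {Ω : Type*} {mΩ : MeasurableSpace Ω} {P : Measure Ω} {n m : ℕ}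
  {φ : EuclideanSpace ℝ (Fin n) → EuclideanSpace ℝ (Fin m)}
  {θ : Ω → EuclideanSpace ℝ (Fin m)} {w : ℕ → Ω → ℝ} {y : ℤ → Ω → ℝ} {ℱ : Filtration ℕ mΩ}
  {μ : Measure ℝ}

/-- The event that the window at `i` lies in the ball of radius `M` and the parameter in the ball
of radius `R`. -/
def boundedAt (n : ℕ) (y : ℤ → Ω → ℝ) (θ : Ω → EuclideanSpace ℝ (Fin m)) (M R : ℝ) (i : ℕ) :
    Set Ω :=
  {ω | ‖window n (fun s => y s ω) i‖ ≤ M ∧ ‖θ ω‖ ≤ R}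

/-- The event that the window at `i + n` lies in `A`. -/
def nextIn (y : ℤ → Ω → ℝ) (A : Set (EuclideanSpace ℝ (Fin n))) (i : ℕ) : Set Ω :=
  {ω | window n (fun s => y s ω) (i + n) ∈ A}

theorem IsModel.measurableSet_boundedAt (h : IsModel φ θ w y) (hw : IsAdaptedNoise P ℱ w μ)
    (hφ : Continuous φ) (hθ : Measurable[ℱ 0] θ) (hy : Measurable[ℱ 0] (y 0)) (M R : ℝ)
    {i b : ℕ} (hb : i + n ≤ b + 1) : MeasurableSet[ℱ b] (boundedAt n y θ M R i) := by
  have h1 : Measurable[ℱ b] fun ω => window n (fun s => y s ω) i :=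
    measurable_window fun r hr => h.measurable_path hw hφ hθ hy b r (by lia)
  have h2 : Measurable[ℱ b] θ := hθ.mono (ℱ.mono (Nat.zero_le _)) le_rfl
  exact MeasurableSet.inter ((measurable_norm.comp h1) (measurableSet_Iic (a := M)))
    ((measurable_norm.comp h2) (measurableSet_Iic (a := R)))

theorem IsModel.measurableSet_nextIn (h : IsModel φ θ w y) (hw : IsAdaptedNoise P ℱ w μ)
    (hφ : Continuous φ) (hθ : Measurable[ℱ 0] θ) (hy : Measurable[ℱ 0] (y 0))
    {A : Set (EuclideanSpace ℝ (Fin n))} (hA : MeasurableSet A)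
    {i b : ℕ} (hb : i + 2 * n ≤ b + 1) : MeasurableSet[ℱ b] (nextIn y A i) := by
  have h1 : Measurable[ℱ b] fun ω => window n (fun s => y s ω) (i + n) :=
    measurable_window fun r hr => h.measurable_path hw hφ hθ hy b r (by lia)
  exact h1 hA

/-- From a bounded window, the window `n` steps later visits any set in a cube with conditional
probability at least a multiple of its volume. -/
theorem IsModel.exists_lintegral_nextIn_ge [IsProbabilityMeasure P] (h : IsModel φ θ w y)
    (hw : IsAdaptedNoise P ℱ w μ) (hφ : Continuous φ) (hθ : Measurable[ℱ 0] θ)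
    (hy : Measurable[ℱ 0] (y 0)) (hμ : HasLocallyPositiveDensity μ) {L M R : ℝ} (hL : 0 < L)
    (hR : 0 ≤ R) :
    ∃ κ : ℝ, 0 < κ ∧ ∀ (A : Set (EuclideanSpace ℝ (Fin n))), MeasurableSet A →
      (∀ z ∈ A, ∀ k, |z k| ≤ L) → ∀ (i b : ℕ), b + 1 = i + n →
      ∀ f : Ω → ℝ≥0∞, Measurable[ℱ b] f →
        ENNReal.ofReal κ * volume A * ∫⁻ ω in boundedAt n y θ M R i, f ω ∂P ≤
          ∫⁻ ω in boundedAt n y θ M R i ∩ nextIn y A i, f ω ∂P := by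
  obtain ⟨K, hK0, hK⟩ := exists_norm_le_of_continuous hφ (max L M)
  obtain ⟨c, hc0, hc⟩ := hμ (L + R * K) (by positivity)
  -- One factor `c` for each of the `n` outputs of the new window.
  refine ⟨c ^ n, by positivity, fun A hA hAL i b hb f hf => ?_⟩
  have hBm : MeasurableSet[ℱ b] (boundedAt n y θ M R i) :=
    h.measurableSet_boundedAt hw hφ hθ hy M R hb.ge
  have hBm' := ℱ.le _ _ hBm
  have hAm' : MeasurableSet (nextIn y A i) := ℱ.le _ _
    (h.measurableSet_nextIn hw hφ hθ hy hA (b := i + 2 * n) (by lia))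
  set A' : Set (Fin n → ℝ) := WithLp.toLp 2 ⁻¹' A with hA'
  have hA'm : MeasurableSet A' := WithLp.measurable_toLp 2 (Fin n → ℝ) hA
  have hvol : volume A' = volume A :=
    (PiLp.volume_preserving_toLp (Fin n)).measure_preimage hA.nullMeasurableSet
  have hsub : A' ⊆ cube L n := fun x hx k _ => abs_le.1 (hAL _ hx k)
  have key := h.lintegral_block_ge hw hφ hθ hy (L := L) (M := M) (R := R) (V := R * K)
    (fun z hz => mul_le_mul_of_nonneg_left (hK z hz) hR) hc hb (hf.indicator hBm)
    (fun ω hω => by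
      by_contra hn
      exact hω (Set.indicator_of_notMem (s := boundedAt n y θ M R i) hn f)) n le_rfl
    (g := A'.indicator 1) (measurable_one.indicator hA'm)
  rw [lintegral_indicator hBm', lintegral_indicator_one hA'm,
    Measure.restrict_apply hA'm, Set.inter_eq_left.2 hsub, hvol] at key
  rw [ENNReal.ofReal_pow hc0.le, mul_right_comm]
  refine key.trans (le_of_eq ?_)
  rw [← lintegral_indicator (hBm'.inter hAm')]
  refine lintegral_congr fun ω => ?_
  have hwin : window n (fun s => y s ω) (i + n) = WithLp.toLp 2 (block y b n ω) := by
    simp only [window]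
    congr 1; funext k
    simp only [block]
    congr 1; lia
  have hiff : block y b n ω ∈ A' ↔ ω ∈ nextIn y A i := by
    simp only [hA', Set.mem_preimage, nextIn, Set.mem_ofPred_eq, hwin]
  by_cases hω : ω ∈ boundedAt n y θ M R i <;> by_cases ha : ω ∈ nextIn y A i <;>
    simp [Set.indicator, hω, ha, hiff]

theorem hits_add (D : ℕ → Set Ω) (s t : ℕ) (ω : Ω) :
    hits D (s + t) ω = hits D s ω + hits (fun i => D (s + i)) t ω := by
  induction t with
  | zero => simp [hits_zero]
  | succ t ih =>
    rw [← add_assoc]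
    by_cases hd : ω ∈ D (s + t)
    · rw [hits_succ_of_mem hd, hits_succ_of_mem (D := fun i => D (s + i)) hd, ih, add_assoc]
    · rw [hits_succ_of_notMem hd, hits_succ_of_notMem (D := fun i => D (s + i)) hd, ih]

theorem hits_le (D : ℕ → Set Ω) (t : ℕ) (ω : Ω) : hits D t ω ≤ t := by
  classical
  exact Nat.count_le _

theorem hits_eq_sum (D : ℕ → Set Ω) (t : ℕ) (ω : Ω) :
    hits D t ω = ∑ i ∈ Finset.range t, (D i).indicator 1 ω := by
  induction t with
  | zero => simp [hits_zero]
  | succ t ih =>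
    rw [Finset.sum_range_succ]
    by_cases hd : ω ∈ D t
    · rw [hits_succ_of_mem hd, ih, Set.indicator_of_mem hd]; rfl
    · rw [hits_succ_of_notMem hd, ih, Set.indicator_of_notMem hd]; rfl

/-- Splitting times by residue modulo `n` makes successive trials sequential: within a class, the
outcome of one trial is known when the next begins. -/
theorem hits_mul_eq_sum (D : ℕ → Set Ω) (n q : ℕ) (ω : Ω) :
    hits D (q * n) ω = ∑ r ∈ Finset.range n, hits (fun k => D (k * n + r)) q ω := by
  induction q with
  | zero => simp [hits_zero]
  | succ q ih =>
    rw [Nat.succ_mul, hits_add, ih, hits_eq_sum, ← Finset.sum_add_distrib]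
    refine Finset.sum_congr rfl fun r _ => ?_
    by_cases hd : ω ∈ D (q * n + r)
    · rw [hits_succ_of_mem (D := fun k => D (k * n + r)) hd, Set.indicator_of_mem hd]; rfl
    · rw [hits_succ_of_notMem (D := fun k => D (k * n + r)) hd, Set.indicator_of_notMem hd]; rfl

/-- A set of positive volume in a cube is visited a positive proportion of the times when the
window and the parameter are bounded. -/
theorem IsModel.exists_ae_hits_le [IsProbabilityMeasure P] (hn : 0 < n) (h : IsModel φ θ w y)
    (hw : IsAdaptedNoise P ℱ w μ) (hφ : Continuous φ) (hθ : Measurable[ℱ 0] θ)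
    (hy : Measurable[ℱ 0] (y 0)) (hμ : HasLocallyPositiveDensity μ) {L M R : ℝ} (hL : 0 < L)
    (hR : 0 ≤ R) {A : Set (EuclideanSpace ℝ (Fin n))} (hA : MeasurableSet A)
    (hAL : ∀ z ∈ A, ∀ k, |z k| ≤ L) (hvol : volume A ≠ 0) :
    ∃ κ : ℝ, 0 < κ ∧ ∀ᵐ ω ∂P, ∃ C : ℝ, ∀ t,
      κ * hits (boundedAt n y θ M R) t ω ≤ hits (nextIn y A) t ω + C := by
  obtain ⟨κ₀, hκ₀, hge⟩ := h.exists_lintegral_nextIn_ge hw hφ hθ hy hμ (M := M) hL hR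
  obtain ⟨v, hv0, hvA⟩ : ∃ v : ℝ, 0 < v ∧ ENNReal.ofReal v ≤ volume A := by
    obtain ⟨q, hq0, hq⟩ := ENNReal.lt_iff_exists_nnreal_btwn.1 (pos_iff_ne_zero.2 hvol)
    exact ⟨q, by simpa using hq0, by simpa using hq.le⟩
  set κ := κ₀ * v with hκ
  have hκ0 : 0 < κ := by positivity
  set B := boundedAt n y θ M R with hB
  set N := nextIn y A with hN
  have hres : ∀ r : ℕ, ∀ᵐ ω ∂P, ∃ C : ℝ, ∀ t,
      κ / 2 * hits (fun k => B (k * n + r)) t ω ≤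
        Real.log 2 * hits (fun k => B (k * n + r) ∩ N (k * n + r)) t ω + C := by
    intro r
    -- The last coordinate of the window at `k * n + r` to be observed has time `k * n + r + n - 1`;
    -- one index later in `𝒢`, the window `n` steps on has been observed.
    let 𝒢 : Filtration ℕ mΩ :=
      { seq := fun k => ℱ (k * n + r + n - 1)
        mono' := fun a b hab => ℱ.mono (by
          have := Nat.mul_le_mul_right n hab
          lia)
        le' := fun k => ℱ.le _ }
    refine ae_exists_forall_hits_le (ℱ := 𝒢) hκ0.le (fun k => ?_) (fun k => ?_) fun k f hf => ?_
    · exact h.measurableSet_boundedAt hw hφ hθ hy M R (by lia)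
    · refine h.measurableSet_nextIn hw hφ hθ hy hA ?_
      have := Nat.succ_mul k n
      lia
    · refine le_trans ?_ (hge A hA hAL (k * n + r) (k * n + r + n - 1) (by lia) f hf)
      gcongr
      rw [hκ, ENNReal.ofReal_mul hκ₀.le]
      gcongr
  have hlog : 0 < Real.log 2 := Real.log_pos one_lt_two
  refine ⟨κ / 2 / Real.log 2, by positivity, ?_⟩
  filter_upwards [ae_all_iff.2 hres] with ω hω
  choose C hC using hω
  -- The term `κ / 2 * n` pays for the incomplete last group of fewer than `n` times.
  refine ⟨(∑ r ∈ Finset.range n, C r + κ / 2 * n) / Real.log 2, fun t => ?_⟩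
  have ht : t / n * n ≤ t := Nat.div_mul_le_self t n
  have h1 : hits B t ω ≤ hits B (t / n * n) ω + n := by
    have e := Nat.div_add_mod' t n
    conv_lhs => rw [← e, hits_add]
    have := hits_le (fun i => B (t / n * n + i)) (t % n) ω
    have := Nat.mod_lt t hn
    lia
  have h2 : hits (fun i => B i ∩ N i) (t / n * n) ω ≤ hits N t ω :=
    (hits_le_hits fun i _ hi => hi.2).trans (hits_mono N ω ht)
  have h3 : κ / 2 * hits B (t / n * n) ω ≤
      Real.log 2 * hits (fun i => B i ∩ N i) (t / n * n) ω + ∑ r ∈ Finset.range n, C r := by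
    rw [hits_mul_eq_sum, hits_mul_eq_sum]
    push_cast
    rw [Finset.mul_sum, Finset.mul_sum, ← Finset.sum_add_distrib]
    exact Finset.sum_le_sum fun r _ => hC r _
  have h1' : (hits B t ω : ℝ) ≤ hits B (t / n * n) ω + n := by exact_mod_cast h1
  have h2' : (hits (fun i => B i ∩ N i) (t / n * n) ω : ℝ) ≤ hits N t ω := by exact_mod_cast h2
  rw [div_mul_eq_mul_div, ← sub_le_iff_le_add', div_sub' hlog.ne', div_le_div_iff_of_pos_right hlog]
  nlinarith

end Excitation

/-! ### Excitation in every direction and the smallest eigenvalue -/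

section Persistence

variable {Ω : Type*} {mΩ : MeasurableSpace Ω} {P : Measure Ω} {n m : ℕ}
  {φ : EuclideanSpace ℝ (Fin n) → EuclideanSpace ℝ (Fin m)}
  {θ : Ω → EuclideanSpace ℝ (Fin m)} {w : ℕ → Ω → ℝ} {y : ℤ → Ω → ℝ} {ℱ : Filtration ℕ mΩ}
  {μ : Measure ℝ}

theorem exists_pos_norm_bound {E : Set (EuclideanSpace ℝ (Fin n))} (hE : Bornology.IsBounded E) :
    ∃ L : ℝ, 0 < L ∧ ∀ z ∈ E, ‖z‖ ≤ L := by
  obtain ⟨L, hL⟩ := hE.exists_norm_le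
  exact ⟨max L 1, by positivity, fun z hz => (hL z hz).trans (le_max_left _ _)⟩

/-- Finitely many directions control all of them on a bounded set. -/
theorem exists_finset_directions (hφ : Continuous φ) {E : Set (EuclideanSpace ℝ (Fin n))}
    (hE : Bornology.IsBounded E) {δ : ℝ} (hδ : 0 < δ) :
    ∃ T : Finset (EuclideanSpace ℝ (Fin m)), (∀ x ∈ T, ‖x‖ = 1) ∧
      ∀ x : EuclideanSpace ℝ (Fin m), ‖x‖ = 1 → ∃ x' ∈ T, ∀ z ∈ E,
        δ < |inner ℝ (φ z) x'| → δ / 2 < |inner ℝ (φ z) x| := by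
  obtain ⟨L, hL0, hL⟩ := exists_pos_norm_bound hE
  obtain ⟨K, hK0, hK⟩ := exists_norm_le_of_continuous hφ L
  obtain ⟨T, hTs, hTf, hT⟩ := finite_cover_balls_of_compact
    (isCompact_sphere (0 : EuclideanSpace ℝ (Fin m)) 1)
    -- With `‖φ‖ ≤ K` on `E`, moving the direction by this radius changes the inner product by at
    -- most `δ / 2`; the `+ 1` covers `K = 0`.
    (show 0 < δ / (2 * (K + 1)) by positivity)
  refine ⟨hTf.toFinset, fun x hx => by simpa using hTs (hTf.mem_toFinset.1 hx), fun x hx => ?_⟩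
  obtain ⟨x', hx', hd⟩ := Set.mem_iUnion₂.1 (hT (by simpa using hx : x ∈ Metric.sphere _ _))
  refine ⟨x', hTf.mem_toFinset.2 hx', fun z hz hlt => ?_⟩
  have hφz : ‖φ z‖ ≤ K := hK z fun k => (abs_coord_le_norm z k).trans (hL z hz)
  have h1 : |inner ℝ (φ z) x'| ≤ |inner ℝ (φ z) x| + |inner ℝ (φ z) (x' - x)| := by
    rw [inner_sub_right]
    calc |inner ℝ (φ z) x'| = |inner ℝ (φ z) x + (inner ℝ (φ z) x' - inner ℝ (φ z) x)| := by
          congr 1; ring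
      _ ≤ _ := abs_add_le _ _
  have h2 : |inner ℝ (φ z) (x' - x)| ≤ K * (δ / (2 * (K + 1))) := by
    refine (abs_real_inner_le_norm _ _).trans ?_
    rw [Metric.mem_ball, dist_comm, dist_eq_norm] at hd
    gcongr
  have h3 : K * (δ / (2 * (K + 1))) ≤ δ / 2 := by
    rw [mul_div_assoc', div_le_div_iff₀ (by positivity) two_pos]
    nlinarith
  linarith

/-- The argument is `t + 1` because `hits` counts the times `0, …, t` and `visits` the times `1, …,
t`. -/
theorem visits_le_hits {M R : ℝ} {ω : Ω} (hR : ‖θ ω‖ ≤ R) (t : ℕ) :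
    visits n M (fun s => y s ω) t ≤ hits (boundedAt n y θ M R) (t + 1) ω := by
  classical
  rw [hits, Nat.count_eq_card_filter_range, visits]
  refine Finset.card_le_card fun i hi => ?_
  simp only [Finset.mem_filter, Finset.mem_Icc, Finset.mem_range] at hi ⊢
  exact ⟨by lia, hi.2, hR⟩

theorem exists_pos_le_of_finset {α : Type*} (T : Finset α) {κ : α → ℝ} (h : ∀ x ∈ T, 0 < κ x) :
    ∃ k : ℝ, 0 < k ∧ ∀ x ∈ T, k ≤ κ x := by
  rcases T.eq_empty_or_nonempty with rfl | hT
  · exact ⟨1, one_pos, by simp⟩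
  · obtain ⟨x, hx, hmin⟩ := T.exists_min_image κ hT
    exact ⟨κ x, h x hx, hmin⟩

/-- The regressors are exciting in every direction, in proportion to the number of visits of the
window to a ball. -/
theorem IsModel.ae_sum_inner_sq_ge [IsProbabilityMeasure P] (hn : 0 < n) (h : IsModel φ θ w y)
    (hw : IsAdaptedNoise P ℱ w μ) (hφ : Continuous φ) (hθ : Measurable[ℱ 0] θ)
    (hy : Measurable[ℱ 0] (y 0)) (hμ : HasLocallyPositiveDensity μ)
    {E : Set (EuclideanSpace ℝ (Fin n))} (hEo : IsOpen E) (hE : Bornology.IsBounded E)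
    {δ : ℝ} (hδ : 0 < δ)
    (hvol : ∀ x : EuclideanSpace ℝ (Fin m), ‖x‖ = 1 →
      volume {z | z ∈ E ∧ δ < |inner ℝ (φ z) x|} ≠ 0) (M : ℝ) :
    ∀ᵐ ω ∂P, ∃ κ : ℝ, 0 < κ ∧ ∃ C : ℝ, ∀ ψ : ℕ → EuclideanSpace ℝ (Fin m),
      (∀ j : ℕ, window n (fun s => y s ω) ((j : ℤ) - n + 1) ∈ E →
        ψ j = regressor φ (fun s => y s ω) j) →
      ∀ (t : ℕ) (x : EuclideanSpace ℝ (Fin m)), ‖x‖ = 1 →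
        κ * visits n M (fun s => y s ω) t ≤
          ∑ j ∈ Finset.range t, inner ℝ (ψ j) x ^ 2 + C := by
  obtain ⟨L, hL0, hL⟩ := exists_pos_norm_bound hE
  obtain ⟨T, hT1, hT⟩ := exists_finset_directions hφ hE hδ
  let A : EuclideanSpace ℝ (Fin m) → Set (EuclideanSpace ℝ (Fin n)) := fun x =>
    {z | z ∈ E ∧ δ < |inner ℝ (φ z) x|}
  have hAm : ∀ x, MeasurableSet (A x) := fun x => by
    have hcont : Continuous fun z => |inner ℝ (φ z) x| := by fun_prop
    exact (hEo.inter (isOpen_lt continuous_const hcont)).measurableSet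
  have hvisit : ∀ (R : ℕ) (x : T), ∃ κ : ℝ, 0 < κ ∧ ∀ᵐ ω ∂P, ∃ C : ℝ, ∀ t,
      κ * hits (boundedAt n y θ M R) t ω ≤ hits (nextIn y (A x)) t ω + C := fun R x =>
    h.exists_ae_hits_le hn hw hφ hθ hy hμ hL0 (Nat.cast_nonneg R) (hAm x)
      (fun z hz k => (abs_coord_le_norm z k).trans (hL z hz.1)) (hvol x (hT1 x x.2))
  choose κ hκ0 hκ using hvisit
  have hae := ae_all_iff.2 fun R => ae_all_iff.2 fun x => hκ R x
  filter_upwards [hae] with ω hω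
  -- The parameter may be unbounded over `Ω`, so the almost sure statement is taken for all integer
  -- radii and the radius chosen path by path; hence `κ` depends on `ω`.
  obtain ⟨R, hR⟩ := exists_nat_ge ‖θ ω‖
  choose C hC using hω R
  obtain ⟨k, hk0, hk⟩ := exists_pos_le_of_finset Finset.univ (κ := κ R) fun x _ => hκ0 R x
  obtain ⟨D, hD⟩ : ∃ D : ℝ, ∀ x, C x ≤ D :=
    ⟨∑ x, |C x|, fun x => (le_abs_self _).trans
      (Finset.single_le_sum (f := fun x => |C x|) (fun _ _ => abs_nonneg _) (Finset.mem_univ x))⟩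
  refine ⟨δ ^ 2 / 4 * k, by positivity, δ ^ 2 / 4 * (D + k * (2 * n + 1)),
    fun ψ hψ t x hx => ?_⟩
  obtain ⟨x', hx', hxx'⟩ := hT x hx
  -- A trial at `i` excites the regressor of index `2 * n - 1 + i`, so trials before `s` use only
  -- regressors before `t`. The discarded times number at most `2 * n + 1`, also when the
  -- subtraction truncates to `0`.
  set s := t - 2 * n with hs
  set N := nextIn y (A x') with hN
  set B := boundedAt n y θ M R with hB
  have h1 : k * hits B s ω ≤ hits N s ω + D := by
    have e1 := hC ⟨x', hx'⟩ s
    have e2 := hk ⟨x', hx'⟩ (Finset.mem_univ _)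
    have e3 := hD ⟨x', hx'⟩
    have e4 : k * hits B s ω ≤ κ R ⟨x', hx'⟩ * hits B s ω := by gcongr
    linarith
  have h2 : (visits n M (fun s => y s ω) t : ℝ) ≤ hits B s ω + (2 * n + 1) := by
    have e1 := visits_le_hits (n := n) (M := M) (y := y) hR t
    have e2 : hits B (t + 1) ω ≤ hits B (s + (2 * n + 1)) ω := hits_mono B ω (by lia)
    rw [hits_add B s] at e2
    have e3 := hits_le (fun i => B (s + i)) (2 * n + 1) ω
    exact_mod_cast (by lia : visits n M (fun s => y s ω) t ≤ hits B s ω + (2 * n + 1))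
  have hterm : ∀ i, ω ∈ N i → δ ^ 2 / 4 ≤ inner ℝ (ψ (2 * n - 1 + i)) x ^ 2 := by
    intro i hi
    have hidx : ((2 * n - 1 + i : ℕ) : ℤ) - n + 1 = i + n := by lia
    have hψi := hψ (2 * n - 1 + i) (by rw [hidx]; exact hi.1)
    have hlt := hxx' _ hi.1 hi.2
    rw [hψi, regressor, hidx, ← sq_abs (inner ℝ _ x)]
    calc δ ^ 2 / 4 = (δ / 2) ^ 2 := by ring
      _ ≤ _ := by gcongr
  have hpartial : ∀ r, δ ^ 2 / 4 * hits N r ω ≤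
      ∑ i ∈ Finset.range r, inner ℝ (ψ (2 * n - 1 + i)) x ^ 2 := by
    intro r
    induction r with
    | zero => simp [hits_zero]
    | succ r ih =>
      rw [Finset.sum_range_succ]
      by_cases hd : ω ∈ N r
      · rw [hits_succ_of_mem hd]
        push_cast
        linarith [hterm r hd]
      · rw [hits_succ_of_notMem hd]
        linarith [sq_nonneg (inner ℝ (ψ (2 * n - 1 + r)) x)]
  have h3 : δ ^ 2 / 4 * hits N s ω ≤ ∑ j ∈ Finset.range t, inner ℝ (ψ j) x ^ 2 := by
    rcases Nat.eq_zero_or_pos s with h0 | h0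
    · rw [h0, hits_zero]
      simpa using Finset.sum_nonneg fun j _ => sq_nonneg (inner ℝ (ψ j) x)
    · refine (hpartial s).trans ?_
      have hsub : Finset.range (2 * n - 1 + s) ⊆ Finset.range t :=
        Finset.range_subset_range.2 (by lia)
      refine le_trans ?_ (Finset.sum_le_sum_of_subset_of_nonneg hsub fun j _ _ => sq_nonneg _)
      rw [Finset.sum_range_add]
      linarith [Finset.sum_nonneg (s := Finset.range (2 * n - 1))
        fun j _ => sq_nonneg (inner ℝ (ψ j) x)]
  have hδ2 : 0 < δ ^ 2 / 4 := by positivity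
  calc δ ^ 2 / 4 * k * visits n M (fun s => y s ω) t
      ≤ δ ^ 2 / 4 * k * (hits B s ω + (2 * n + 1)) := by gcongr
    _ = δ ^ 2 / 4 * (k * hits B s ω) + δ ^ 2 / 4 * (k * (2 * n + 1)) := by ring
    _ ≤ δ ^ 2 / 4 * (hits N s ω + D) + δ ^ 2 / 4 * (k * (2 * n + 1)) := by gcongr
    _ ≤ _ := by linarith

theorem mul_norm_sq_le_sum_inner_sq {ψ : ℕ → EuclideanSpace ℝ (Fin m)} {t : ℕ} {κ : ℝ}
    (h : ∀ x : EuclideanSpace ℝ (Fin m), ‖x‖ = 1 →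
      κ ≤ ∑ j ∈ Finset.range t, inner ℝ (ψ j) x ^ 2) (v : EuclideanSpace ℝ (Fin m)) :
    κ * ‖v‖ ^ 2 ≤ ∑ j ∈ Finset.range t, inner ℝ (ψ j) v ^ 2 := by
  rcases eq_or_ne v 0 with rfl | hv
  · simp
  have hv0 : 0 < ‖v‖ := norm_pos_iff.2 hv
  have hx := h (‖v‖⁻¹ • v) (by rw [norm_smul, norm_inv, norm_norm, inv_mul_cancel₀ hv0.ne'])
  simp only [inner_smul_right, mul_pow, ← Finset.mul_sum, inv_pow] at hx
  rwa [le_inv_mul_iff₀ (by positivity), mul_comm] at hx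

theorem toLp_infoMatrix_mulVec (ψ : ℕ → EuclideanSpace ℝ (Fin m)) (t : ℕ)
    (v : EuclideanSpace ℝ (Fin m)) :
    WithLp.toLp 2 (infoMatrix ψ t *ᵥ v.ofLp) =
      v + ∑ i ∈ Finset.range t, (inner ℝ (ψ i) v : ℝ) • ψ i := by
  ext k
  simp only [infoMatrix, Matrix.add_mulVec, Matrix.one_mulVec, Matrix.sum_mulVec,
    Matrix.vecMulVec_mulVec]
  simp [EuclideanSpace.inner_eq_star_dotProduct, dotProduct_comm]

theorem inner_infoMatrix_mulVec (ψ : ℕ → EuclideanSpace ℝ (Fin m)) (t : ℕ)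
    (v : EuclideanSpace ℝ (Fin m)) :
    inner ℝ v (WithLp.toLp 2 (infoMatrix ψ t *ᵥ v.ofLp)) =
      ‖v‖ ^ 2 + ∑ i ∈ Finset.range t, inner ℝ (ψ i) v ^ 2 := by
  rw [toLp_infoMatrix_mulVec, inner_add_right, real_inner_self_eq_norm_sq, inner_sum]
  congr 1
  refine Finset.sum_congr rfl fun i _ => ?_
  rw [inner_smul_right, real_inner_comm, sq]

/-- The Rayleigh quotient at an eigenvector. Positivity of `m` guarantees a real eigenvalue, without
which the infimum would take the default value `0`. -/
theorem le_lamMin (hm : 0 < m) {ψ : ℕ → EuclideanSpace ℝ (Fin m)} {t : ℕ} {κ : ℝ}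
    (h : ∀ x : EuclideanSpace ℝ (Fin m), ‖x‖ = 1 →
      κ ≤ ∑ j ∈ Finset.range t, inner ℝ (ψ j) x ^ 2) : κ ≤ lamMin ψ t := by
  refine le_csInf ?_ fun ρ hρ => ?_
  · have hA := (posDef_infoMatrix ψ t).1
    refine ⟨hA.eigenvalues ⟨0, hm⟩, ?_⟩
    rw [Set.mem_ofPred_eq, Module.End.hasEigenvalue_iff_mem_spectrum, Matrix.spectrum_toLin']
    exact hA.eigenvalues_mem_spectrum_real _
  · obtain ⟨v, hv⟩ := Module.End.HasEigenvalue.exists_hasEigenvector hρ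
    have hmul : infoMatrix ψ t *ᵥ v = ρ • v := by
      rw [← Matrix.toLin'_apply]; exact hv.apply_eq_smul
    set V : EuclideanSpace ℝ (Fin m) := WithLp.toLp 2 v with hV
    have hV0 : V ≠ 0 := fun h0 => hv.2 (by simpa [hV] using h0)
    have e := inner_infoMatrix_mulVec ψ t V
    rw [hV, hmul, WithLp.toLp_smul, ← hV, inner_smul_right, real_inner_self_eq_norm_sq] at e
    have hle := mul_norm_sq_le_sum_inner_sq h V
    have hp : 0 < ‖V‖ ^ 2 := by positivity
    nlinarith

/-- Once `N t ≥ 2 C / κ`, the additive constant absorbs at most half of `κ N t`. The liminf is taken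
in `EReal`, so no upper bound on the ratio is needed. -/
theorem pos_liminf_lamMin_div (hm : 0 < m) {ψ : ℕ → EuclideanSpace ℝ (Fin m)} {N : ℕ → ℕ}
    (hN : Tendsto N atTop atTop) {κ C : ℝ} (hκ : 0 < κ)
    (h : ∀ (t : ℕ) (x : EuclideanSpace ℝ (Fin m)), ‖x‖ = 1 →
      κ * N t ≤ ∑ j ∈ Finset.range t, inner ℝ (ψ j) x ^ 2 + C) :
    0 < liminf (fun t : ℕ => ((lamMin ψ (t + 1) / (N t : ℝ) : ℝ) : EReal)) atTop := by
  have hlim : Tendsto (fun t => (N t : ℝ)) atTop atTop := tendsto_natCast_atTop_atTop.comp hN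
  refine lt_of_lt_of_le (EReal.coe_pos.2 (half_pos hκ)) (le_liminf_of_le (by isBoundedDefault) ?_)
  filter_upwards [hlim.eventually_gt_atTop 0, hlim.eventually_ge_atTop (2 * C / κ)] with t h0 h1
  rw [EReal.coe_le_coe_iff, le_div_iff₀ h0]
  rw [div_le_iff₀ hκ] at h1
  refine le_lamMin hm fun x hx => ?_
  have h2 := h t x hx
  rw [Finset.sum_range_succ]
  linarith [sq_nonneg (inner ℝ (ψ t) x)]

end Persistence

/-! ### Consistency of least squares -/

section LeastSquares

variable {Ω : Type*} {mΩ : MeasurableSpace Ω} {P : Measure Ω} {n m : ℕ}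
  {φ : EuclideanSpace ℝ (Fin n) → EuclideanSpace ℝ (Fin m)}
  {w : ℕ → Ω → ℝ} {y : ℤ → Ω → ℝ} {ℱ : Filtration ℕ mΩ} {μ : Measure ℝ}

/-- The normal equations in recursive form: `gain` inverts `infoMatrix`, so a correction adds the
innovation times `ψ t`, while the rank-one update of the matrix cancels the estimation error inside
that innovation. A zero regressor contributes nothing, so the model equation is needed only at kept
steps. -/
theorem infoMatrix_mulVec_lsEstimate_sub (θ₀ θ : EuclideanSpace ℝ (Fin m))
    {ψ : ℕ → EuclideanSpace ℝ (Fin m)} {y : ℤ → ℝ} {e : ℕ → ℝ}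
    (h : ∀ i : ℕ, ψ i ≠ 0 → y ((i : ℤ) + 1) = inner ℝ θ (ψ i) + e (i + 1)) (t : ℕ) :
    WithLp.toLp 2 (infoMatrix ψ t *ᵥ (lsEstimate θ₀ ψ y t - θ).ofLp) =
      (θ₀ - θ) + ∑ i ∈ Finset.range t, e (i + 1) • ψ i := by
  induction t with
  | zero => simp [infoMatrix, lsEstimate]
  | succ t ih =>
    set d := lsEstimate θ₀ ψ y t - θ with hd
    set c := y ((t : ℤ) + 1) - inner ℝ (ψ t) (lsEstimate θ₀ ψ y t) with hc
    have hinv : infoMatrix ψ (t + 1) * gain ψ (t + 1) = 1 :=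
      mul_eq_one_comm.1 (gain_mul_infoMatrix ψ (t + 1))
    have hstep : lsEstimate θ₀ ψ y (t + 1) - θ =
        d + c • WithLp.toLp 2 (gain ψ (t + 1) *ᵥ (ψ t).ofLp) := by
      rw [lsEstimate, hd]; abel
    have hsplit : WithLp.toLp 2 (infoMatrix ψ (t + 1) *ᵥ (lsEstimate θ₀ ψ y (t + 1) - θ).ofLp) =
        WithLp.toLp 2 (infoMatrix ψ (t + 1) *ᵥ d.ofLp) + c • ψ t := by
      rw [hstep, WithLp.ofLp_add, Matrix.mulVec_add, WithLp.ofLp_smul, Matrix.mulVec_smul,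
        Matrix.mulVec_mulVec, hinv, Matrix.one_mulVec, WithLp.toLp_add, WithLp.toLp_smul]
    rw [hsplit, toLp_infoMatrix_mulVec, Finset.sum_range_succ, ← add_assoc,
      ← toLp_infoMatrix_mulVec, ih, Finset.sum_range_succ, add_assoc, add_assoc,
      ← add_smul]
    congr 2
    by_cases hψ : ψ t = 0
    · rw [hψ, smul_zero, smul_zero]
    · congr 1
      rw [hc, h t hψ, hd, inner_sub_right, real_inner_comm θ (ψ t)]
      ring

/-- Pair the normal equations with the error `d`: coercivity gives `κ ‖d‖² ≤ ⟪d, S⟫ ≤ ‖d‖ ‖S‖`. The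
Euclidean norm of the noise sum is then at most the sum of its coordinates' absolute values, which
are scalar sums with predictable weights. -/
theorem norm_lsEstimate_sub_le (θ₀ θ : EuclideanSpace ℝ (Fin m))
    {ψ : ℕ → EuclideanSpace ℝ (Fin m)} {y : ℤ → ℝ} {e : ℕ → ℝ}
    (h : ∀ i : ℕ, ψ i ≠ 0 → y ((i : ℤ) + 1) = inner ℝ θ (ψ i) + e (i + 1)) {t : ℕ} {κ : ℝ}
    (hκ : ∀ x : EuclideanSpace ℝ (Fin m), ‖x‖ = 1 →
      κ ≤ ∑ j ∈ Finset.range t, inner ℝ (ψ j) x ^ 2) :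
    κ * ‖lsEstimate θ₀ ψ y t - θ‖ ≤
      ‖θ₀ - θ‖ + ∑ k, |∑ i ∈ Finset.range t, ψ i k * e (i + 1)| := by
  set d := lsEstimate θ₀ ψ y t - θ with hd
  set S := (θ₀ - θ) + ∑ i ∈ Finset.range t, e (i + 1) • ψ i with hS
  have h1 : WithLp.toLp 2 (infoMatrix ψ t *ᵥ d.ofLp) = S :=
    infoMatrix_mulVec_lsEstimate_sub θ₀ θ h t
  have h2 := inner_infoMatrix_mulVec ψ t d
  rw [h1] at h2
  have h3 := mul_norm_sq_le_sum_inner_sq hκ d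
  have h4 := real_inner_le_norm d S
  have h5 : κ * ‖d‖ ≤ ‖S‖ := by
    rcases eq_or_ne d 0 with h0 | h0
    · rw [h0]; simp
    · refine le_of_mul_le_mul_left ?_ (norm_pos_iff.2 h0)
      nlinarith [sq_nonneg ‖d‖]
  refine h5.trans ((norm_add_le _ _).trans (add_le_add le_rfl ?_))
  refine abs_le_of_sq_le_sq' ?_ (Finset.sum_nonneg fun _ _ => abs_nonneg _) |>.2
  rw [EuclideanSpace.real_norm_sq_eq]
  refine le_trans (le_of_eq ?_) (Finset.sum_sq_le_sq_sum_of_nonneg fun k _ => abs_nonneg _)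
  refine Finset.sum_congr rfl fun k _ => ?_
  rw [sq_abs]
  congr 1
  simp [mul_comm]

/-- Passes from the clock of kept regressors to the visit count: `h ≤ 2 N ≤ N²` doubles each factor
under the root at most. -/
theorem sqrt_mul_log_le {h N n : ℕ} (h1 : h ≤ N + n) (hn : n ≤ N) (hN : 3 ≤ N) :
    Real.sqrt (h * Real.log h) ≤ 2 * Real.sqrt (N * Real.log N) := by
  have hN3 : (3 : ℝ) ≤ N := by exact_mod_cast hN
  have hh : (h : ℝ) ≤ 2 * N := by exact_mod_cast (by lia : h ≤ 2 * N)
  have hlog : Real.log h ≤ 2 * Real.log N := by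
    rcases Nat.eq_zero_or_pos h with rfl | h0
    · simpa using Real.log_nonneg (by linarith)
    · rw [← Real.log_rpow (by linarith)]
      refine Real.log_le_log (by exact_mod_cast h0) ?_
      norm_cast
      nlinarith
  have hlog0 : 0 ≤ Real.log N := Real.log_nonneg (by linarith)
  have e : 2 * Real.sqrt (N * Real.log N) = Real.sqrt ((2 * N) * (2 * Real.log N)) := by
    rw [show (2 * (N : ℝ)) * (2 * Real.log N) = 2 ^ 2 * (N * Real.log N) by ring,
      Real.sqrt_mul (by norm_num : (0 : ℝ) ≤ 2 ^ 2), Real.sqrt_sq two_pos.le]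
  rw [e]
  refine Real.sqrt_le_sqrt ?_
  exact mul_le_mul hh hlog (Real.log_natCast_nonneg h) (by positivity)

/-- The event that the regressor at `t` is kept. -/
def keptAt (n : ℕ) (y : ℤ → Ω → ℝ) (C : ℝ) (t : ℕ) : Set Ω :=
  {ω | ‖window n (fun s => y s ω) ((t : ℤ) - n + 1)‖ ≤ C}

/-- The regressor at `i` uses the window at `i - n + 1`, so kept steps correspond to visits up to a
shift by `n - 1`. The first `n` steps have windows at indices `≤ 0`, which `visits` does not count.
-/
theorem hits_keptAt_le {C M : ℝ} (hCM : C ≤ M) (t : ℕ) (ω : Ω) :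
    hits (keptAt n y C) t ω ≤ visits n M (fun s => y s ω) t + n := by
  classical
  have hsub : ((Finset.range t).filter fun i => ω ∈ keptAt n y C i) ⊆
      ((Finset.Icc 1 t).filter fun i : ℕ => ‖window n (fun s => y s ω) (i : ℤ)‖ ≤ M).image
        (fun i => i + n - 1) ∪ Finset.range n := by
    intro i hi
    simp only [Finset.mem_filter, Finset.mem_range, Finset.mem_union, Finset.mem_image,
      Finset.mem_Icc] at hi ⊢
    rcases lt_or_ge i n with h | h
    · exact Or.inr h
    · refine Or.inl ⟨i - n + 1, ⟨⟨by lia, by lia⟩, ?_⟩, by lia⟩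
      have : ((i - n + 1 : ℕ) : ℤ) = (i : ℤ) - n + 1 := by lia
      rw [this]
      exact le_trans hi.2 hCM
  rw [hits, Nat.count_eq_card_filter_range, visits]
  refine (Finset.card_le_card hsub).trans ((Finset.card_union_le _ _).trans ?_)
  rw [Finset.card_range]
  exact Nat.add_le_add_right Finset.card_image_le n

theorem truncRegressor_of_mem {C : ℝ} {t : ℕ} {ω : Ω} (h : ω ∈ keptAt n y C t) :
    truncRegressor φ C (fun s => y s ω) t = regressor φ (fun s => y s ω) t := by
  classical
  exact if_pos h

theorem truncRegressor_of_notMem {C : ℝ} {t : ℕ} {ω : Ω} (h : ω ∉ keptAt n y C t) :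
    truncRegressor φ C (fun s => y s ω) t = 0 := by
  classical
  exact if_neg h

theorem norm_truncRegressor_le {C K : ℝ}
    (hK : ∀ z : EuclideanSpace ℝ (Fin n), (∀ k, |z k| ≤ C) → ‖φ z‖ ≤ K) (t : ℕ) (ω : Ω) :
    ‖truncRegressor φ C (fun s => y s ω) t‖ ≤ (keptAt n y C t).indicator (fun _ => K) ω := by
  by_cases h : ω ∈ keptAt n y C t
  · rw [truncRegressor_of_mem h, Set.indicator_of_mem h]
    exact hK _ fun k => (abs_coord_le_norm _ k).trans h
  · rw [truncRegressor_of_notMem h, Set.indicator_of_notMem h, norm_zero]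

theorem IsModel.measurableSet_keptAt {θ : Ω → EuclideanSpace ℝ (Fin m)} (h : IsModel φ θ w y)
    (hw : IsAdaptedNoise P ℱ w μ) (hφ : Continuous φ) (hθ : Measurable[ℱ 0] θ)
    (hy : Measurable[ℱ 0] (y 0)) (C : ℝ) (t : ℕ) : MeasurableSet[ℱ t] (keptAt n y C t) := by
  have h1 : Measurable[ℱ t] fun ω => window n (fun s => y s ω) ((t : ℤ) - n + 1) :=
    measurable_window fun r hr => h.measurable_path hw hφ hθ hy t r (by lia)
  exact (measurable_norm.comp h1) (measurableSet_Iic (a := C))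

theorem IsModel.measurable_truncRegressor {θ : Ω → EuclideanSpace ℝ (Fin m)}
    (h : IsModel φ θ w y) (hw : IsAdaptedNoise P ℱ w μ) (hφ : Continuous φ)
    (hθ : Measurable[ℱ 0] θ) (hy : Measurable[ℱ 0] (y 0)) (C : ℝ) (t : ℕ) :
    Measurable[ℱ t] fun ω => truncRegressor φ C (fun s => y s ω) t := by
  classical
  have h1 : Measurable[ℱ t] fun ω => window n (fun s => y s ω) ((t : ℤ) - n + 1) :=
    measurable_window fun r hr => h.measurable_path hw hφ hθ hy t r (by lia)
  have h2 : (fun ω => truncRegressor φ C (fun s => y s ω) t) =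
      (keptAt n y C t).indicator fun ω => regressor φ (fun s => y s ω) t := by
    funext ω
    by_cases hω : ω ∈ keptAt n y C t
    · rw [truncRegressor_of_mem hω, Set.indicator_of_mem hω]
    · rw [truncRegressor_of_notMem hω, Set.indicator_of_notMem hω]
  rw [h2]
  exact (hφ.measurable.comp h1).indicator (h.measurableSet_keptAt hw hφ hθ hy C t)

/-- Least squares is consistent at the rate `log N / N` once the regressors are exciting in
proportion to the number `N` of visits. -/
theorem IsModel.ae_lsEstimate_isBigO [IsProbabilityMeasure P] [IsProbabilityMeasure μ]
    (hm : 0 < m) {θ : EuclideanSpace ℝ (Fin m)} (h : IsModel φ (fun _ => θ) w y)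
    (hw : IsAdaptedNoise P ℱ w μ) (hφ : Continuous φ) (hy : Measurable[ℱ 0] (y 0))
    (h0 : ∫ x, x ∂μ = 0) {β : ℝ} (hβ : 2 < β) (hint : Integrable (fun x => |x| ^ β) μ)
    {C M : ℝ} (hCM : C ≤ M) (θ₀ : EuclideanSpace ℝ (Fin m)) :
    ∀ᵐ ω ∂P, Tendsto (fun t => visits n M (fun s => y s ω) t) atTop atTop →
      (∃ κ : ℝ, 0 < κ ∧ ∃ D : ℝ, ∀ (t : ℕ) (x : EuclideanSpace ℝ (Fin m)), ‖x‖ = 1 →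
        κ * visits n M (fun s => y s ω) t ≤ ∑ j ∈ Finset.range t,
          inner ℝ (truncRegressor φ C (fun s => y s ω) j) x ^ 2 + D) →
      (fun t : ℕ => ‖lsEstimate θ₀ (truncRegressor φ C (fun s => y s ω))
          (fun s => y s ω) t - θ‖ ^ 2) =O[atTop]
        (fun t : ℕ => Real.log (visits n M (fun s => y s ω) t : ℝ) /
          (visits n M (fun s => y s ω) t : ℝ)) := by
  obtain ⟨K', hK'0, hK'⟩ := exists_norm_le_of_continuous hφ C
  obtain ⟨K, hK0, hK⟩ : ∃ K : ℝ, 0 < K ∧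
      ∀ z : EuclideanSpace ℝ (Fin n), (∀ k, |z k| ≤ C) → ‖φ z‖ ≤ K :=
    ⟨K' + 1, by positivity, fun z hz => (hK' z hz).trans (by linarith)⟩
  have hθ : Measurable[ℱ 0] fun _ : Ω => θ := measurable_const
  have hcoord : ∀ k : Fin m, ∃ c : ℝ, 0 ≤ c ∧ ∀ᵐ ω ∂P, ∃ k₀ : ℕ, ∀ t,
      k₀ ≤ hits (keptAt n y C) t ω →
      |∑ i ∈ Finset.range t, truncRegressor φ C (fun s => y s ω) i k * w (i + 1) ω| ≤
        c * Real.sqrt (hits (keptAt n y C) t ω * Real.log (hits (keptAt n y C) t ω)) := by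
    intro k
    refine hw.ae_abs_sum_le h0 hβ hint (u := fun i ω => truncRegressor φ C (fun s => y s ω) i k)
      (fun t => ?_) (h.measurableSet_keptAt hw hφ hθ hy C) hK0 fun t ω =>
        (abs_coord_le_norm _ k).trans (norm_truncRegressor_le hK t ω)
    have hk : Measurable fun v : EuclideanSpace ℝ (Fin m) => v k := by fun_prop
    exact hk.comp (h.measurable_truncRegressor hw hφ hθ hy C t)
  choose c hc0 hc using hcoord
  filter_upwards [ae_all_iff.2 hc] with ω hω hN ⟨κ, hκ, D, hD⟩
  choose k₀ hk₀ using hω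
  set ψ := truncRegressor φ C (fun s => y s ω) with hψ
  set N := fun t => visits n M (fun s => y s ω) t with hNdef
  set H := fun t => hits (keptAt n y C) t ω with hH
  have hNr : Tendsto (fun t => (N t : ℝ)) atTop atTop := tendsto_natCast_atTop_atTop.comp hN
  have hψK : ∀ t, ∑ j ∈ Finset.range t, ‖ψ j‖ ^ 2 ≤ K ^ 2 * H t := by
    intro t
    induction t with
    | zero => simp [hH, hits_zero]
    | succ t ih =>
      have hb := norm_truncRegressor_le (y := y) hK t ω
      rw [Finset.sum_range_succ]
      by_cases hd : ω ∈ keptAt n y C t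
      · rw [Set.indicator_of_mem hd] at hb
        have : ‖ψ t‖ ^ 2 ≤ K ^ 2 := by gcongr
        simp only [hH, hits_succ_of_mem hd] at ih ⊢
        push_cast
        linarith
      · rw [Set.indicator_of_notMem hd] at hb
        have h0 : ‖ψ t‖ = 0 := le_antisymm hb (norm_nonneg _)
        simp only [hH, hits_succ_of_notMem hd] at ih ⊢
        rw [h0]
        linarith
  -- The noise bound requires many kept steps. Excitation in one fixed direction forces them, since
  -- each kept regressor adds at most `K ^ 2` to the energy.
  have hHr : Tendsto (fun t => (H t : ℝ)) atTop atTop := by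
    have hlow : ∀ t, (κ * N t - D) / K ^ 2 ≤ H t := by
      intro t
      rw [div_le_iff₀ (by positivity), mul_comm (H t : ℝ)]
      refine le_trans ?_ (hψK t)
      have e1 := hD t (EuclideanSpace.single ⟨0, hm⟩ 1) (by simp)
      rw [← sub_le_iff_le_add] at e1
      refine e1.trans (Finset.sum_le_sum fun j _ => ?_)
      have e2 := abs_real_inner_le_norm (ψ j) (EuclideanSpace.single ⟨0, hm⟩ (1 : ℝ))
      rw [← sq_abs]
      gcongr
      simpa using e2
    refine tendsto_atTop_mono hlow ?_
    refine Tendsto.atTop_div_const (by positivity) ?_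
    exact tendsto_atTop_add_const_right _ (-D) (hNr.const_mul_atTop hκ)
  have hHt : Tendsto H atTop atTop := tendsto_natCast_atTop_iff.1 hHr
  set a := ‖θ₀ - θ‖ with ha
  set b := ∑ k, c k with hb
  have hb0 : 0 ≤ b := Finset.sum_nonneg fun k _ => hc0 k
  have hmodel : ∀ i : ℕ, ψ i ≠ 0 →
      y ((i : ℤ) + 1) ω = inner ℝ θ (ψ i) + w (i + 1) ω := by
    intro i hi
    by_cases hd : ω ∈ keptAt n y C i
    · rw [hψ, truncRegressor_of_mem hd, h.step]
    · exact absurd (truncRegressor_of_notMem hd) hi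
  refine IsBigO.of_bound ((a + 2 * b) ^ 2 / (κ / 2) ^ 2) ?_
  -- These thresholds give `n ≤ N` and `3 ≤ N`, hence `log N ≥ 1`, so the initial error `a` is at
  -- most `a * r`; they also absorb `D` into half of `κ N` and activate every coordinate's noise
  -- bound.
  filter_upwards [hN.eventually_ge_atTop (n + 3), hNr.eventually_ge_atTop (2 * D / κ),
    hHt.eventually_ge_atTop (∑ k, k₀ k)] with t h1 h2 h3
  have hN3 : 3 ≤ N t := by lia
  have hN3' : (3 : ℝ) ≤ N t := by exact_mod_cast hN3
  set r := Real.sqrt (N t * Real.log (N t)) with hr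
  have hlog1 : 1 ≤ Real.log (N t) := by
    rw [Real.le_log_iff_exp_le (by linarith)]
    linarith [Real.exp_one_lt_d9]
  have hr1 : 1 ≤ r := Real.one_le_sqrt.2 (by nlinarith)
  have hκt : ∀ x : EuclideanSpace ℝ (Fin m), ‖x‖ = 1 →
      κ / 2 * N t ≤ ∑ j ∈ Finset.range t, inner ℝ (ψ j) x ^ 2 := by
    intro x hx
    have := hD t x hx
    rw [div_le_iff₀ hκ] at h2
    linarith
  have hmain := norm_lsEstimate_sub_le θ₀ θ (y := fun s => y s ω) (e := fun i => w i ω)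
    hmodel hκt
  have hsum : ∑ k, |∑ i ∈ Finset.range t, ψ i k * w (i + 1) ω| ≤ b * (2 * r) := by
    rw [hb, Finset.sum_mul]
    refine Finset.sum_le_sum fun k _ => ?_
    have hk : k₀ k ≤ H t :=
      (Finset.single_le_sum (f := k₀) (fun _ _ => Nat.zero_le _) (Finset.mem_univ k)).trans h3
    refine (hk₀ k t hk).trans (mul_le_mul_of_nonneg_left ?_ (hc0 k))
    exact sqrt_mul_log_le (hits_keptAt_le hCM t ω) (by lia) hN3
  set d := ‖lsEstimate θ₀ ψ (fun s => y s ω) t - θ‖ with hd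
  have hle : κ / 2 * N t * d ≤ (a + 2 * b) * r := by
    have : a ≤ a * r := le_mul_of_one_le_right (norm_nonneg _) hr1
    linarith
  have hsq : (κ / 2 * N t * d) ^ 2 ≤ ((a + 2 * b) * r) ^ 2 := by
    have : 0 ≤ d := norm_nonneg _
    gcongr
  have hr2 : r ^ 2 = N t * Real.log (N t) := Real.sq_sqrt (by positivity)
  rw [Real.norm_of_nonneg (by positivity), Real.norm_of_nonneg (by positivity),
    div_mul_div_comm, le_div_iff₀ (by positivity)]
  rw [mul_pow _ r, hr2, mul_pow, mul_pow] at hsq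
  have hN0 : (0 : ℝ) < N t := by linarith
  refine le_of_mul_le_mul_left ?_ hN0
  linarith

end LeastSquares

theorem continuous_of_continuous_coord {n m : ℕ}
    {φ : EuclideanSpace ℝ (Fin n) → EuclideanSpace ℝ (Fin m)}
    (h : ∀ i, Continuous fun z => φ z i) : Continuous φ :=
  (PiLp.continuous_toLp 2 _).comp (continuous_pi h)

end NAR

end

/-! ### The two settings combined -/

theorem theorem3 {n m : ℕ} (hn : 0 < n) (hm : 0 < m)
    (φ : EuclideanSpace ℝ (Fin n) → EuclideanSpace ℝ (Fin m))
    (hφ : NAR.LevelSetCondition φ) :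
    -- random Gaussian parameter
    (∀ (Ω : Type*) [MeasurableSpace Ω] (P : Measure Ω) [IsProbabilityMeasure P]
      (μ₀ : EuclideanSpace ℝ (Fin m)) (θ : Ω → EuclideanSpace ℝ (Fin m))
      (w : ℕ → Ω → ℝ) (y : ℤ → Ω → ℝ),
      NAR.BayesianSetting P μ₀ θ w y → NAR.IsModel φ θ w y →
      ∀ M : ℝ, 0 < M →
        ∀ᵐ ω ∂P, Tendsto (fun t => NAR.visits n M (fun s => y s ω) t) atTop atTop →
          0 < liminf (fun t : ℕ =>
            ((NAR.lamMin (NAR.regressor φ (fun s => y s ω)) (t + 1) /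
              (NAR.visits n M (fun s => y s ω) t : ℝ) : ℝ) : EReal)) atTop) ∧
    -- constant parameter, truncated regressors
    (∃ Mφ : ℝ, 0 < Mφ ∧
      ∀ (Ω : Type*) [MeasurableSpace Ω] (P : Measure Ω) [IsProbabilityMeasure P]
        (θ : EuclideanSpace ℝ (Fin m)) (w : ℕ → Ω → ℝ) (y : ℤ → Ω → ℝ),
        NAR.ConstantSetting P w y → NAR.IsModel φ (fun _ => θ) w y →
        ∀ C : ℝ, Mφ < C → ∀ M : ℝ, 0 < M →
          (∀ᵐ ω ∂P, Tendsto (fun t => NAR.visits n M (fun s => y s ω) t) atTop atTop →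
            0 < liminf (fun t : ℕ =>
              ((NAR.lamMin (NAR.truncRegressor φ C (fun s => y s ω)) (t + 1) /
                (NAR.visits n M (fun s => y s ω) t : ℝ) : ℝ) : EReal)) atTop) ∧
          (C ≤ M → ∀ θ₀ : EuclideanSpace ℝ (Fin m),
            ∀ᵐ ω ∂P, Tendsto (fun t => NAR.visits n M (fun s => y s ω) t) atTop atTop →
              (fun t : ℕ =>
                ‖NAR.lsEstimate θ₀ (NAR.truncRegressor φ C (fun s => y s ω))
                  (fun s => y s ω) t - θ‖ ^ 2) =O[atTop]
              (fun t : ℕ =>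
                Real.log (NAR.visits n M (fun s => y s ω) t : ℝ) /
                  (NAR.visits n M (fun s => y s ω) t : ℝ)))) := by
  obtain ⟨E, δ, hEo, hE, hδ, hcoord, -, hinf⟩ := hφ
  have hcont : Continuous φ := NAR.continuous_of_continuous_coord hcoord
  have hvol : ∀ x : EuclideanSpace ℝ (Fin m), ‖x‖ = 1 →
      volume {z | z ∈ E ∧ δ < |inner ℝ (φ z) x|} ≠ 0 := fun x hx =>
    (hinf.trans_le (iInf_le _ (⟨x, by simpa using hx⟩ :
      Metric.sphere (0 : EuclideanSpace ℝ (Fin m)) 1))).ne'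
  refine ⟨?_, ?_⟩
  · intro Ω _ P _ μ₀ θ w y hs hmod M _
    obtain ⟨ℱ, hw, hU⟩ := NAR.exists_isAdaptedNoise (hs.measurable_param.prodMk hs.measurable_init)
      hs.measurable_noise hs.iIndep_noise hs.law_noise hs.indep
    filter_upwards [hmod.ae_sum_inner_sq_ge hn hw hcont (measurable_fst.comp hU)
      (measurable_snd.comp hU) NAR.hasLocallyPositiveDensity_gaussianReal hEo hE hδ hvol M]
      with ω ⟨κ, hκ, C, hC⟩ hN
    exact NAR.pos_liminf_lamMin_div hm hN hκ (hC _ fun _ _ => rfl)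
  -- The constant is the radius of a ball containing `E`: beyond it, truncation leaves untouched
  -- every regressor whose window lies in `E`, and only these are used for excitation.
  · obtain ⟨L, hL0, hL⟩ := NAR.exists_pos_norm_bound hE
    refine ⟨L, hL0, ?_⟩
    intro Ω _ P _ θ w y hs hmod C hC M _
    have hw1 : Measurable (w 1) := hs.measurable_noise 0
    have hp : IsProbabilityMeasure (P.map (w 1)) :=
      Measure.isProbabilityMeasure_map hw1.aemeasurable
    obtain ⟨ℱ, hw, hy⟩ := NAR.exists_isAdaptedNoise (μ := P.map (w 1)) hs.measurable_init
      hs.measurable_noise hs.iIndep_noise (fun t => (hs.identDistrib_noise t).map_eq) hs.indep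
    have hμ : NAR.HasLocallyPositiveDensity (P.map (w 1)) := by
      obtain ⟨ρ, hρ, -, hlaw, hpos, -⟩ := hs.density_noise
      rw [hlaw]
      exact NAR.hasLocallyPositiveDensity_withDensity hρ hpos
    have hexc : ∀ᵐ ω ∂P, ∃ κ : ℝ, 0 < κ ∧ ∃ D : ℝ, ∀ (t : ℕ) (x : EuclideanSpace ℝ (Fin m)),
        ‖x‖ = 1 → κ * NAR.visits n M (fun s => y s ω) t ≤ ∑ j ∈ Finset.range t,
          inner ℝ (NAR.truncRegressor φ C (fun s => y s ω) j) x ^ 2 + D := by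
      filter_upwards [hmod.ae_sum_inner_sq_ge hn hw hcont measurable_const hy hμ hEo hE hδ hvol M]
        with ω ⟨κ, hκ, D, hD⟩
      exact ⟨κ, hκ, D, hD _ fun j hj => NAR.truncRegressor_of_mem ((hL _ hj).trans hC.le)⟩
    refine ⟨?_, fun hCM θ₀ => ?_⟩
    · filter_upwards [hexc] with ω ⟨κ, hκ, D, hD⟩ hN
      exact NAR.pos_liminf_lamMin_div hm hN hκ hD
    · obtain ⟨β, hβ, hint⟩ := hs.moment_noise
      have hmean : ∫ x, x ∂(P.map (w 1)) = 0 := by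
        rw [integral_map hw1.aemeasurable (by fun_prop)]; exact hs.mean_noise
      have hint' : Integrable (fun x => |x| ^ β) (P.map (w 1)) := by
        rw [integrable_map_measure
          (Measurable.aestronglyMeasurable (by fun_prop)) hw1.aemeasurable]
        exact hint
      filter_upwards [hexc, hmod.ae_lsEstimate_isBigO hm hw hcont hy hmean hβ hint' hCM θ₀]
        with ω h1 h2 hN
      exact h2 hN h1
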